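/- Let $n\ge 0$. A string link $T$ on $n$ strands is an oriented tangle, i.e. an equivalence class of oriented tangle diagrams in $\mathbb R\times[0,1]$ under planar isotopy and Reidemeister moves, which has $n$ bottom and $n$ top endpoints, all oriented upwards, and which consists of exactly $n$ interval components, each running from a bottom endpoint to a top endpoint (no closed components). In a diagram of $T$ an admissible path follows the orientation of $T$ and goes from a bottom endpoint to a top endpoint; when it approaches a crossing on the undercrossing strand it goes straight on (weight $1$); when it approaches a crossing on the overcrossing strand it either goes straight on (weight $t$ at a positive crossing, $t^{-1}$ at a negative one) or drops onto the undercrossing strand and follows its direction (weight $1-t$ at a positive crossing, $1-t^{-1}$ at a negative one). The weight $w(P)$ of a path $P$ is the product of these weights over all crossings it passes, with repetitions. The random walk invariant $\gamma_n(T)$ is the $n\times n$ matrix over $\mathbb Q(t)$ whose entry $\gamma_n(T)_{j,i}$ is the rational function that for all real $t$ sufficiently close to $1$ equals the (convergent) sum $\sum_P w(P)$ over all admissible paths $P$ from the $i$-th bottom endpoint to the $j$-th top endpoint. Then, for every string link $T$ on $n$ strands, $\gamma_n(T)$ is well defined (the sums converge near $t=1$ to unique rational functions, which are the same for all diagrams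 of $T$), and with the row vector $e_n=(1,\dots,1)$ and the column vector $v_n=(1,t,\dots,t^{n-1})^T$ we have $$e_n\,\gamma_n(T)=e_n\qquad\text{and}\qquad \gamma_n(T)\,v_n=v_n .$$ In particular all column sums of $\gamma_n(T)$ are equal to $1$. Consequently, for $n\ge 1$, the normalized vector $p_n=\frac{1}{\langle e_n,v_n\rangle}v_n$, whose entries sum to $1$ and which for every real $t\in[0,1]$ is a probability vector, does not depend on $T$ and satisfies $\gamma_n(T)\,p_n=p_n$ for every string link $T$ on $n$ strands (an equilibrium state independent of $T$). -/

import Mathlib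

open Matrix Topology

namespace StringLinks

/-! ### Oriented tangle diagrams, cut into elementary pieces

A tangle diagram in `ℝ × [0,1]` in general position with respect to the height function is a
stack of horizontal slices, read from bottom to top, each of which contains exactly one crossing,
local minimum or local maximum besides vertical strands.  The word of signs at a horizontal level
is a list of Booleans: `true` is an upward strand (`+`), `false` a downward one (`-`). -/

/-- The elementary pieces of an oriented tangle diagram.
* `crossing ε δ o`: one strand of sign `ε` joins the bottom left to the top right and one of sign
  `δ` joins the bottom right to the top left; the former is the overcrossing one iff `o = true`.
* `cup ε`: a local minimum whose left end has sign `ε` and whose right end has the opposite sign.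
* `cap ε`: a local maximum whose left end has sign `ε` and whose right end has the opposite sign. -/
inductive Piece : Type
  | crossing (ε δ o : Bool)
  | cup (ε : Bool)
  | cap (ε : Bool)

/-- The signs at the bottom of a piece. -/
def Piece.src : Piece → List Bool
  | .crossing ε δ _ => [ε, δ]
  | .cup _ => []
  | .cap ε => [ε, !ε]

/-- The signs at the top of a piece. -/
def Piece.tgt : Piece → List Bool
  | .crossing ε δ _ => [δ, ε]
  | .cup ε => [ε, !ε]
  | .cap _ => []

/-- A slice: an elementary piece with vertical strands to the left and to the right of it. -/
structure Slice : Type where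
  left : List Bool
  piece : Piece
  right : List Bool

/-- The signs at the bottom of a slice. -/
def Slice.src (x : Slice) : List Bool := x.left ++ x.piece.src ++ x.right

/-- The signs at the top of a slice. -/
def Slice.tgt (x : Slice) : List Bool := x.left ++ x.piece.tgt ++ x.right

/-- `IsTangleDiagram s D t`: the slices in `D` (listed from bottom to top) fit together to a
tangle diagram from the word of signs `s` at the bottom to the word `t` at the top. -/
def IsTangleDiagram : List Bool → List Slice → List Bool → Prop
  | s, [], t => s = t
  | s, x :: D, t => x.src = s ∧ IsTangleDiagram x.tgt D t

/-! ### Travelling along a diagram -/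

/-- A boundary point of a slice, at its bottom or at its top; positions count from `0`. -/
inductive Port : Type
  | bot (p : ℕ)
  | top (p : ℕ)

/-- Shift a boundary point `l` positions to the right. -/
def Port.shift (l : ℕ) : Port → Port
  | .bot p => .bot (l + p)
  | .top p => .top (l + p)

/-- Where one enters a strand of sign `ε` with lower end `a` and upper end `b`. -/
def entry (ε : Bool) (a b : Port) : Port := if ε then a else b

/-- Where one leaves a strand of sign `ε` with lower end `a` and upper end `b`. -/
def leave (ε : Bool) (a b : Port) : Port := if ε then b else a

/-- The ways in which an admissible path may traverse a piece of the diagram: along a strand away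
from crossings, along the undercrossing strand of a crossing, straight along the overcrossing
strand, or dropping from the overcrossing to the undercrossing strand.  In the last two cases the
Boolean is `true` if the crossing is positive and `false` if it is negative. -/
inductive Passage : Type
  | plain
  | under
  | over (positive : Bool)
  | drop (positive : Bool)

/-- The weight of a passage at the parameter `t`. -/
noncomputable def Passage.weight (t : ℝ) : Passage → ℝ
  | .plain => 1
  | .under => 1
  | .over true => t
  | .over false => t⁻¹
  | .drop true => 1 - t
  | .drop false => 1 - t⁻¹

/-- A passage that does not change from one strand of the tangle to another. -/
def Passage.IsStraight : Passage → Prop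
  | .drop _ => False
  | _ => True

/-- The sign of the crossing `Piece.crossing ε δ o`: with both strands upward it is positive iff
the strand from the bottom left to the top right is over, and reversing one of the two strands
changes the sign. -/
def isPositive (ε δ o : Bool) : Bool := o == (ε == δ)

/-- `e.Pass a b k`: a path following the orientations can traverse the piece `e` from its boundary
point `a` to its boundary point `b` by a passage of kind `k`. -/
inductive Piece.Pass : Piece → Port → Port → Passage → Prop
  /- The strand of sign `ε` is over. -/
  | over₁ (ε δ : Bool) : Piece.Pass (.crossing ε δ true)
      (entry ε (.bot 0) (.top 1)) (leave ε (.bot 0) (.top 1)) (.over (isPositive ε δ true))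
  | drop₁ (ε δ : Bool) : Piece.Pass (.crossing ε δ true)
      (entry ε (.bot 0) (.top 1)) (leave δ (.bot 1) (.top 0)) (.drop (isPositive ε δ true))
  | under₁ (ε δ : Bool) : Piece.Pass (.crossing ε δ true)
      (entry δ (.bot 1) (.top 0)) (leave δ (.bot 1) (.top 0)) .under
  /- The strand of sign `δ` is over. -/
  | over₂ (ε δ : Bool) : Piece.Pass (.crossing ε δ false)
      (entry δ (.bot 1) (.top 0)) (leave δ (.bot 1) (.top 0)) (.over (isPositive ε δ false))
  | drop₂ (ε δ : Bool) : Piece.Pass (.crossing ε δ false)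
      (entry δ (.bot 1) (.top 0)) (leave ε (.bot 0) (.top 1)) (.drop (isPositive ε δ false))
  | under₂ (ε δ : Bool) : Piece.Pass (.crossing ε δ false)
      (entry ε (.bot 0) (.top 1)) (leave ε (.bot 0) (.top 1)) .under
  | cup (ε : Bool) : Piece.Pass (.cup ε)
      (entry ε (.top 1) (.top 0)) (leave ε (.top 1) (.top 0)) .plain
  | cap (ε : Bool) : Piece.Pass (.cap ε)
      (entry ε (.bot 0) (.bot 1)) (leave ε (.bot 0) (.bot 1)) .plain

/-- The passages through a slice: along one of its vertical strands, or through its piece. -/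
inductive Slice.Pass (x : Slice) : Port → Port → Passage → Prop
  | left (p : ℕ) (ε : Bool) (h : x.left[p]? = some ε) :
      Slice.Pass x (entry ε (.bot p) (.top p)) (leave ε (.bot p) (.top p)) .plain
  | right (p : ℕ) (ε : Bool) (h : x.right[p]? = some ε) :
      Slice.Pass x
        (entry ε (.bot (x.left.length + x.piece.src.length + p))
          (.top (x.left.length + x.piece.tgt.length + p)))
        (leave ε (.bot (x.left.length + x.piece.src.length + p))
          (.top (x.left.length + x.piece.tgt.length + p))) .plain
  | piece (a b : Port) (k : Passage) (h : x.piece.Pass a b k) :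
      Slice.Pass x (a.shift x.left.length) (b.shift x.left.length) k

/-- A point where a diagram meets one of the horizontal lines bounding its slices: the height of
the line and the position on it, both counted from `0`. -/
abbrev Point : Type := ℕ × ℕ

/-- The point of the diagram given by a boundary point of its slice number `h`. -/
def Port.pointAt (h : ℕ) : Port → Point
  | .bot p => (h, p)
  | .top p => (h + 1, p)

/-- `IsPoint s D p`: `p` is a point of the diagram `D` with signs `s` at the bottom. -/
def IsPoint (s : List Bool) (D : List Slice) (p : Point) : Prop :=
  ∃ w : List Bool, (s :: D.map Slice.tgt)[p.1]? = some w ∧ p.2 < w.length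

/-- `Step D p q k`: one can go from `p` to `q` through a single slice by a passage of kind `k`. -/
inductive Step (D : List Slice) : Point → Point → Passage → Prop
  | mk (h : ℕ) (x : Slice) (a b : Port) (k : Passage) (hx : D[h]? = some x) (hp : x.Pass a b k) :
      Step D (a.pointAt h) (b.pointAt h) k

/-- The admissible paths in the diagram `D` between two points. -/
inductive Path (D : List Slice) : Point → Point → Type
  | nil (p : Point) : Path D p p
  | cons {p q r : Point} (k : Passage) (h : Step D p q k) (P : Path D q r) : Path D p r

/-- The weight of an admissible path: the product of the weights of its passages. -/
noncomputable def Path.weight {D : List Slice} (t : ℝ) : {p q : Point} → Path D p q → ℝ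
  | _, _, .nil _ => 1
  | _, _, .cons k _ P => k.weight t * P.weight t

/-- A step along a component of the tangle. -/
def StraightStep (D : List Slice) (p q : Point) : Prop := ∃ k, Step D p q k ∧ k.IsStraight

/-- The word `(+,…,+)` of length `n`. -/
def plusWord (n : ℕ) : List Bool := List.replicate n true

/-! ### String links -/

/-- A diagram of a string link on `n` strands: a tangle diagram from `(+,…,+)` to `(+,…,+)` such
that each of its points lies on a component that runs from a bottom point to a top point.
(So there are exactly `n` components, all of them intervals.) -/
structure StringLinkDiagram (n : ℕ) : Type where
  slices : List Slice
  isTangleDiagram : IsTangleDiagram (plusWord n) slices (plusWord n)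
  isStringLink : ∀ p : Point, IsPoint (plusWord n) slices p →
    ∃ i < n, ∃ j < n, Relation.ReflTransGen (StraightStep slices) (0, i) p ∧
      Relation.ReflTransGen (StraightStep slices) p (slices.length, j)

/-- The local moves on tangle diagrams cut into slices: planar isotopies and Reidemeister moves,
with arbitrary vertical strands `l` to the left and `r` to the right. -/
inductive LocalMove : List Slice → List Slice → Prop
  /-- Two distant pieces exchange their heights. -/
  | exchange (l m r : List Bool) (e f : Piece) : LocalMove
      [⟨l, e, m ++ f.src ++ r⟩, ⟨l ++ e.tgt ++ m, f, r⟩]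
      [⟨l ++ e.src ++ m, f, r⟩, ⟨l, e, m ++ f.tgt ++ r⟩]
  /-- A minimum and a maximum on the same strand cancel (two mirror images). -/
  | zigzag (l r : List Bool) (ε : Bool) : LocalMove
      [⟨l ++ [ε], .cup (!ε), r⟩, ⟨l, .cap ε, [ε] ++ r⟩] []
  | zagzig (l r : List Bool) (ε : Bool) : LocalMove
      [⟨l, .cup ε, [ε] ++ r⟩, ⟨l ++ [ε], .cap (!ε), r⟩] []
  /-- A strand of sign `δ` crossing one leg of a maximum slides to the other leg. -/
  | slideCap (l r : List Bool) (ε δ o : Bool) : LocalMove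
      [⟨l ++ [ε], .crossing δ (!ε) o, r⟩, ⟨l, .cap ε, [δ] ++ r⟩]
      [⟨l, .crossing ε δ (!o), [!ε] ++ r⟩, ⟨l ++ [δ], .cap ε, r⟩]
  /-- A strand of sign `δ` crossing one leg of a minimum slides to the other leg. -/
  | slideCup (l r : List Bool) (ε δ o : Bool) : LocalMove
      [⟨l, .cup ε, [δ] ++ r⟩, ⟨l ++ [ε], .crossing (!ε) δ o, r⟩]
      [⟨l ++ [δ], .cup ε, r⟩, ⟨l, .crossing δ ε (!o), [!ε] ++ r⟩]
  /-- First Reidemeister move, with the curl on the right or on the left. -/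
  | reidemeister₁Right (l r : List Bool) (ε o : Bool) : LocalMove
      [⟨l ++ [ε], .cup ε, r⟩, ⟨l, .crossing ε ε o, [!ε] ++ r⟩, ⟨l ++ [ε], .cap ε, r⟩] []
  | reidemeister₁Left (l r : List Bool) (ε o : Bool) : LocalMove
      [⟨l, .cup (!ε), [ε] ++ r⟩, ⟨l ++ [!ε], .crossing ε ε o, r⟩, ⟨l, .cap (!ε), [ε] ++ r⟩] []
  /-- Second Reidemeister move. -/
  | reidemeister₂ (l r : List Bool) (ε δ o : Bool) : LocalMove
      [⟨l, .crossing ε δ o, r⟩, ⟨l, .crossing δ ε (!o), r⟩] []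
  /-- Third Reidemeister move for strands with signs `ε, δ, ζ` at the bottom.  The Booleans `u, v, w`
  tell whether the first strand is over the second, the first over the third, and the second over
  the third; the hypothesis says that `over` is a linear order on the three strands. -/
  | reidemeister₃ (l r : List Bool) (ε δ ζ u v w : Bool) (h : u = w → v = u) : LocalMove
      [⟨l, .crossing ε δ u, [ζ] ++ r⟩, ⟨l ++ [δ], .crossing ε ζ v, r⟩,
        ⟨l, .crossing δ ζ w, [ε] ++ r⟩]
      [⟨l ++ [ε], .crossing δ ζ w, r⟩, ⟨l, .crossing ε ζ v, [δ] ++ r⟩,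
        ⟨l ++ [ζ], .crossing ε δ u, r⟩]

/-- One diagram arises from the other by a local move.  (Local moves change neither the number nor
the type of the components, so that nothing is lost by staying within string link diagrams.) -/
def StringLinkDiagram.Move {n : ℕ} (D D' : StringLinkDiagram n) : Prop :=
  ∃ A X X' B : List Slice, LocalMove X X' ∧ D.slices = A ++ X ++ B ∧ D'.slices = A ++ X' ++ B

/-- String links on `n` strands: classes of diagrams under the equivalence relation generated by
the local moves. -/
def StringLink (n : ℕ) : Type := Quot (StringLinkDiagram.Move (n := n))

/-- `D` is a diagram of the string link `T`. -/
def StringLinkDiagram.Presents {n : ℕ} (D : StringLinkDiagram n) (T : StringLink n) : Prop :=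
  Quot.mk _ D = T

/-! ### The random walk invariant -/

/-- The matrix `M` of rational functions describes the weighted path sums in the diagram `D`: for
all real `t` sufficiently close to `1` and all `i`, `j`, the weights at `t` of the admissible paths
from the `i`-th bottom point to the `j`-th top point are summable with sum `M j i` at `t`. -/
def StringLinkDiagram.IsPathSum {n : ℕ} (D : StringLinkDiagram n)
    (M : Matrix (Fin n) (Fin n) (RatFunc ℚ)) : Prop :=
  ∀ᶠ t : ℝ in 𝓝 1, ∀ i j : Fin n,
    HasSum (fun P : Path D.slices (0, i) (D.slices.length, j) => P.weight t)
      ((M j i).eval (algebraMap ℚ ℝ) t)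

open Classical in
/-- The random walk invariant `γ_n(T)`: the matrix over `ℚ(t)` that describes the weighted path
sums in every diagram of `T`. -/
noncomputable def randomWalk {n : ℕ} (T : StringLink n) : Matrix (Fin n) (Fin n) (RatFunc ℚ) :=
  if h : ∃ M, ∀ D : StringLinkDiagram n, D.Presents T → D.IsPathSum M then h.choose else 0

/-- The vector `(1,…,1)`. -/
noncomputable def onesVec (n : ℕ) : Fin n → RatFunc ℚ := fun _ => 1

/-- The vector `(1,t,…,t^{n-1})`. -/
noncomputable def powersVec (n : ℕ) : Fin n → RatFunc ℚ := fun j => RatFunc.X ^ (j : ℕ)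

/-- The vector `(1,t,…,t^{n-1})`, normalized so that its entries sum up to one. -/
noncomputable def equilibrium (n : ℕ) : Fin n → RatFunc ℚ :=
  (onesVec n ⬝ᵥ powersVec n)⁻¹ • powersVec n

end StringLinks

/-! Fix `t ≠ 0` and colour the points of a diagram by numbers so that the colour at each entry of a
piece is the expected colour after the next passage of the random walk. Solved from bottom to top,
this harmonicity becomes the linear colouring rule of the Alexander (Burau) module, `Piece.Colors`;
`diagramColors_iff_isHarmonic` identifies the two descriptions. Over any field, the relation between
bottom and top words that extend to a colouring is preserved by every local move
(`LocalMove.diagramColors_iff`).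

In a string link, going straight on leads from every point to a top end point in a bounded number of
steps, while leaving a strand has weight close to `0` for `t` near `1`. Hence a function growing
exponentially in the remaining number of steps is superharmonic with a gap of `1`
(`isSuperharmonic_of_rank`). This gives absolute convergence of the path sums and a maximum
principle (`IsSuperharmonic.eq_zero`), so a harmonic function is determined by its values `g` at the
top, and its values at the bottom are `f i = ∑ j, g j * γ j i`. Thus the colouring relation is the
graph of the transpose of `γ` (`StringLinkDiagram.diagramColors_iff`), which makes `γ` invariant.

Both fixed vectors come from properties of colourings. Constants are colourings, whence `e γ = e`. A
weighted sum of the colours, the flow, is the same at every height (`DiagramColors.flow_eq`); on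
upward words it is the pairing with `(1, t, …, t ^ (n - 1))`, and applied to colourings whose top
word is a unit vector it gives `γ v = v`.

Rationality is Cramer's rule for the identity minus the transition matrix
(`StringLinkDiagram.pathSum_eq_adjugate`). Identities over `ℚ(t)` follow from those at one
transcendental `t` near `1`, where evaluation is an injective ring homomorphism (`exists_evalHom`).
-/

namespace StringLinks

/-! ### Colourings of diagrams by elements of a field -/

section Coloring

variable {K : Type*} [Field K]

/-- The factor by which the difference to the undercrossing strand is multiplied when one passes
upwards on the overcrossing strand, if the undercrossing strand runs from the bottom right to the
top left with sign `ε`. -/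
def slope (t : K) (ε : Bool) : K := if ε then t⁻¹ else t

theorem slope_ne_zero {t : K} (ht : t ≠ 0) (ε : Bool) : slope t ε ≠ 0 := by
  cases ε <;> simp [slope, ht]

theorem slope_not (t : K) (ε : Bool) : slope t (!ε) = (slope t ε)⁻¹ := by
  cases ε <;> simp [slope]

/-- The colours at the bottom and at the top of a piece fit together. -/
def Piece.Colors (t : K) : Piece → List K → List K → Prop
  -- The undercrossing colour is unchanged. Reversing the overcrossing strand changes both the sign
  -- of the crossing and the direction of travel, so the factor depends on the undercrossing strand
  -- only.
  | .crossing ε δ o, p, q => ∃ a b, p = [a, b] ∧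
      q = if o then [b, b + slope t δ * (a - b)] else [a + slope t (!ε) * (b - a), a]
  | .cup _, p, q => p = [] ∧ ∃ a, q = [a, a]
  | .cap _, p, q => q = [] ∧ ∃ a, p = [a, a]

/-- The colours at the bottom and at the top of a slice fit together. -/
def Slice.Colors (t : K) (x : Slice) (a b : List K) : Prop :=
  ∃ l p q r, l.length = x.left.length ∧ r.length = x.right.length ∧ a = l ++ p ++ r ∧
    b = l ++ q ++ r ∧ x.piece.Colors t p q

/-- The colours at the bottom and at the top of a diagram extend to a colouring. -/
def DiagramColors (t : K) : List Slice → List K → List K → Prop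
  | [], a, c => a = c
  | x :: D, a, c => ∃ b, x.Colors t a b ∧ DiagramColors t D b c

theorem Piece.Colors.length {t : K} {e : Piece} {p q : List K} (h : e.Colors t p q) :
    p.length = e.src.length ∧ q.length = e.tgt.length := by
  rcases e with ⟨ε, δ, _ | _⟩ | ε | ε
  · obtain ⟨a, b, rfl, rfl⟩ := h; simp [Piece.src, Piece.tgt]
  · obtain ⟨a, b, rfl, rfl⟩ := h; simp [Piece.src, Piece.tgt]
  · obtain ⟨rfl, a, rfl⟩ := h; simp [Piece.src, Piece.tgt]
  · obtain ⟨rfl, a, rfl⟩ := h; simp [Piece.src, Piece.tgt]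

theorem Slice.Colors.length {t : K} {x : Slice} {a b : List K} (h : x.Colors t a b) :
    a.length = x.src.length ∧ b.length = x.tgt.length := by
  obtain ⟨l, p, q, r, hl, hr, rfl, rfl, h⟩ := h
  simp [Slice.src, Slice.tgt, hl, hr, h.length]

theorem DiagramColors.length {t : K} {D : List Slice} {s s' : List Bool} {a c : List K}
    (hD : IsTangleDiagram s D s') (h : DiagramColors t D a c) (ha : a.length = s.length) :
    c.length = s'.length := by
  induction D generalizing s a with
  | nil => cases hD; cases h; exact ha
  | cons x D ih =>
    obtain ⟨b, hb, h⟩ := h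
    exact ih hD.2 h hb.length.2

theorem diagramColors_append (t : K) (A B : List Slice) (a c : List K) :
    DiagramColors t (A ++ B) a c ↔ ∃ b, DiagramColors t A a b ∧ DiagramColors t B b c := by
  induction A generalizing a with
  | nil => simp [DiagramColors]
  | cons x A ih =>
    simp only [List.cons_append, DiagramColors, ih]
    constructor
    · rintro ⟨b, hb, d, hd, h⟩; exact ⟨d, ⟨b, hb, hd⟩, h⟩
    · rintro ⟨d, ⟨b, hb, hd⟩, h⟩; exact ⟨b, hb, d, hd, h⟩

theorem isTangleDiagram_append (A B : List Slice) (s s' : List Bool) :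
    IsTangleDiagram s (A ++ B) s' ↔ ∃ w, IsTangleDiagram s A w ∧ IsTangleDiagram w B s' := by
  induction A generalizing s with
  | nil => simp [IsTangleDiagram]
  | cons x A ih =>
    simp only [List.cons_append, IsTangleDiagram, ih]
    constructor
    · rintro ⟨h, w, hw, h'⟩; exact ⟨w, ⟨h, hw⟩, h'⟩
    · rintro ⟨w, ⟨h, hw⟩, h'⟩; exact ⟨h, w, hw, h'⟩

/-- The lengths of the outer words make the decomposition in `Slice.Colors` unique, so its
existential quantifiers disappear. -/
theorem slice_colors_iff (t : K) {l r : List Bool} (e : Piece) {L R : List K} (p b : List K)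
    (hL : L.length = l.length) (hR : R.length = r.length) :
    Slice.Colors t ⟨l, e, r⟩ (L ++ p ++ R) b ↔ ∃ q, b = L ++ q ++ R ∧ e.Colors t p q := by
  constructor
  · rintro ⟨l', p', q, r', hl, hr, h, rfl, hpq⟩
    obtain ⟨h', rfl⟩ := List.append_inj' h (by simp_all)
    obtain ⟨rfl, rfl⟩ := List.append_inj h' (by simp_all)
    exact ⟨q, rfl, hpq⟩
  · rintro ⟨q, rfl, hpq⟩
    exact ⟨L, p, q, R, hL, hR, rfl, rfl, hpq⟩

section Cases

variable {t : K} {l r : List Bool} {L R b : List K}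

theorem colors_crossing_true (hL : L.length = l.length) (hR : R.length = r.length)
    (ε δ : Bool) (x y : K) :
    Slice.Colors t ⟨l, .crossing ε δ true, r⟩ (L ++ x :: y :: R) b ↔
      b = L ++ y :: (y + slope t δ * (x - y)) :: R := by
  have := slice_colors_iff t (.crossing ε δ true) [x, y] b hL hR
  simp only [List.append_assoc, List.cons_append, List.nil_append] at this
  rw [this]
  simp [Piece.Colors]

theorem colors_crossing_false (hL : L.length = l.length) (hR : R.length = r.length)
    (ε δ : Bool) (x y : K) :
    Slice.Colors t ⟨l, .crossing ε δ false, r⟩ (L ++ x :: y :: R) b ↔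
      b = L ++ (x + slope t (!ε) * (y - x)) :: x :: R := by
  have := slice_colors_iff t (.crossing ε δ false) [x, y] b hL hR
  simp only [List.append_assoc, List.cons_append, List.nil_append] at this
  rw [this]
  simp [Piece.Colors]

theorem colors_cup (hL : L.length = l.length) (hR : R.length = r.length)
    (ε : Bool) :
    Slice.Colors t ⟨l, .cup ε, r⟩ (L ++ R) b ↔ ∃ x, b = L ++ x :: x :: R := by
  have := slice_colors_iff t (.cup ε) [] b hL hR
  simp only [List.append_assoc, List.nil_append] at this
  rw [this]
  simp only [Piece.Colors, true_and]
  constructor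
  · rintro ⟨_, rfl, x, rfl⟩; exact ⟨x, by simp⟩
  · rintro ⟨x, rfl⟩; exact ⟨_, by simp, x, rfl⟩

theorem colors_cap (hL : L.length = l.length) (hR : R.length = r.length)
    (ε : Bool) (x y : K) :
    Slice.Colors t ⟨l, .cap ε, r⟩ (L ++ x :: y :: R) b ↔ x = y ∧ b = L ++ R := by
  have := slice_colors_iff t (.cap ε) [x, y] b hL hR
  simp only [List.append_assoc, List.cons_append, List.nil_append] at this
  rw [this]
  simp only [Piece.Colors]
  constructor
  · rintro ⟨_, rfl, rfl, a, h⟩; simp at h; simp [h]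
  · rintro ⟨rfl, rfl⟩; exact ⟨[], by simp, rfl, x, rfl⟩

/-- Local moves also use pieces shifted by one strand. In this form the colour words remain of the
shape `L ++ x :: y :: R`, and the rules for successive slices can be chained by rewriting. -/
theorem colors_crossing_true_succ (hL : L.length = l.length) (hR : R.length = r.length)
    (η ε δ : Bool) (z x y : K) :
    Slice.Colors t ⟨l ++ [η], .crossing ε δ true, r⟩ (L ++ z :: x :: y :: R) b ↔
      b = L ++ z :: y :: (y + slope t δ * (x - y)) :: R := by
  simpa using colors_crossing_true (l := l ++ [η]) (L := L ++ [z]) (by simp [hL]) hR ε δ x y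

theorem colors_crossing_false_succ (hL : L.length = l.length) (hR : R.length = r.length)
    (η ε δ : Bool) (z x y : K) :
    Slice.Colors t ⟨l ++ [η], .crossing ε δ false, r⟩ (L ++ z :: x :: y :: R) b ↔
      b = L ++ z :: (x + slope t (!ε) * (y - x)) :: x :: R := by
  simpa using colors_crossing_false (l := l ++ [η]) (L := L ++ [z]) (by simp [hL]) hR ε δ x y

theorem colors_cup_succ (hL : L.length = l.length) (hR : R.length = r.length)
    (η ε : Bool) (z : K) :
    Slice.Colors t ⟨l ++ [η], .cup ε, r⟩ (L ++ z :: R) b ↔ ∃ x, b = L ++ z :: x :: x :: R := by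
  simpa using colors_cup (l := l ++ [η]) (L := L ++ [z]) (by simp [hL]) hR ε

theorem colors_cap_succ (hL : L.length = l.length) (hR : R.length = r.length)
    (η ε : Bool) (z x y : K) :
    Slice.Colors t ⟨l ++ [η], .cap ε, r⟩ (L ++ z :: x :: y :: R) b ↔
      x = y ∧ b = L ++ z :: R := by
  simpa using colors_cap (l := l ++ [η]) (L := L ++ [z]) (by simp [hL]) hR ε x y

end Cases


end Coloring

/-! ### Invariance of the colouring relation under local moves -/

section Moves

set_option linter.unusedSimpArgs false

/-- Eliminates the intermediate word after a minimum, leaving only the free colour of the new arc.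
-/
theorem exists_eq_exists_and {α β : Type*} (f : α → β) (p : β → Prop) :
    (∃ b, (∃ a, b = f a) ∧ p b) ↔ ∃ a, p (f a) :=
  ⟨fun ⟨_, ⟨a, h⟩, hb⟩ => ⟨a, h ▸ hb⟩, fun ⟨a, h⟩ => ⟨_, ⟨a, rfl⟩, h⟩⟩

theorem exists_append_of_length_eq {α : Type*} {a : List α} {m n : ℕ} (h : a.length = m + n) :
    ∃ L R : List α, a = L ++ R ∧ L.length = m ∧ R.length = n :=
  ⟨a.take m, a.drop m, by simp, by simp [h], by simp [h]⟩

theorem exists_append_cons_of_length_eq {α : Type*} {a : List α} {m n : ℕ}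
    (h : a.length = m + (n + 1)) :
    ∃ (L R : List α) (x : α), a = L ++ x :: R ∧ L.length = m ∧ R.length = n := by
  obtain ⟨L, R, rfl, hL, hR⟩ := exists_append_of_length_eq h
  obtain ⟨x, R, rfl⟩ := List.exists_cons_of_length_eq_add_one hR
  exact ⟨L, R, x, rfl, hL, by simpa using hR⟩

theorem exists_append_cons₂_of_length_eq {α : Type*} {a : List α} {m n : ℕ}
    (h : a.length = m + (n + 2)) :
    ∃ (L R : List α) (x y : α), a = L ++ x :: y :: R ∧ L.length = m ∧ R.length = n := by
  obtain ⟨L, R, x, rfl, hL, hR⟩ := exists_append_cons_of_length_eq h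
  obtain ⟨y, R, rfl⟩ := List.exists_cons_of_length_eq_add_one hR
  exact ⟨L, R, x, y, rfl, hL, by simpa using hR⟩

theorem exists_append_cons₃_of_length_eq {α : Type*} {a : List α} {m n : ℕ}
    (h : a.length = m + (n + 3)) :
    ∃ (L R : List α) (x y z : α), a = L ++ x :: y :: z :: R ∧ L.length = m ∧ R.length = n := by
  obtain ⟨L, R, x, y, rfl, hL, hR⟩ := exists_append_cons₂_of_length_eq h
  obtain ⟨z, R, rfl⟩ := List.exists_cons_of_length_eq_add_one hR
  exact ⟨L, R, x, y, z, rfl, hL, by simpa using hR⟩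

variable {K : Type*} [Field K] {t : K} (l r : List Bool) {a : List K} (c : List K)

theorem diagramColors_pair (x y : Slice) :
    DiagramColors t [x, y] a c ↔ ∃ b, x.Colors t a b ∧ y.Colors t b c := by
  simp [DiagramColors]

theorem diagramColors_triple (x y z : Slice) :
    DiagramColors t [x, y, z] a c ↔
      ∃ b, x.Colors t a b ∧ ∃ b', y.Colors t b b' ∧ z.Colors t b' c := by
  simp [DiagramColors]

theorem diagramColors_nil : DiagramColors t [] a c ↔ c = a := eq_comm

theorem diagramColors_exchange (m : List Bool) (e f : Piece)
    (ha : a.length = l.length + (e.src.length + (m.length + (f.src.length + r.length)))) :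
    DiagramColors t [⟨l, e, m ++ f.src ++ r⟩, ⟨l ++ e.tgt ++ m, f, r⟩] a c ↔
      DiagramColors t [⟨l ++ e.src ++ m, f, r⟩, ⟨l, e, m ++ f.tgt ++ r⟩] a c := by
  obtain ⟨L, a, rfl, hL, ha⟩ := exists_append_of_length_eq ha
  obtain ⟨E, a, rfl, hE, ha⟩ := exists_append_of_length_eq ha
  obtain ⟨M, a, rfl, hM, ha⟩ := exists_append_of_length_eq ha
  obtain ⟨F, R, rfl, hF, hR⟩ := exists_append_of_length_eq ha
  -- The two pieces act on disjoint blocks of colours; this description does not depend on their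
  -- order.
  trans ∃ E' F', c = L ++ E' ++ M ++ F' ++ R ∧ e.Colors t E E' ∧ f.Colors t F F'
  · rw [diagramColors_pair, show L ++ (E ++ (M ++ (F ++ R))) = L ++ E ++ (M ++ F ++ R) by simp]
    simp only [slice_colors_iff t (l := l) (r := m ++ f.src ++ r) e (L := L) (R := M ++ F ++ R) E _
      hL (by simp [hM, hF, hR])]
    constructor
    · rintro ⟨_, ⟨E', rfl, hE'⟩, h⟩
      rw [show L ++ E' ++ (M ++ F ++ R) = L ++ E' ++ M ++ F ++ R by simp,
        slice_colors_iff t f F c (by simp [hL, hM, hE'.length]) hR] at h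
      obtain ⟨F', rfl, hF'⟩ := h
      exact ⟨E', F', rfl, hE', hF'⟩
    · rintro ⟨E', F', rfl, hE', hF'⟩
      refine ⟨_, ⟨E', rfl, hE'⟩, ?_⟩
      rw [show L ++ E' ++ (M ++ F ++ R) = L ++ E' ++ M ++ F ++ R by simp,
        slice_colors_iff t f F _ (by simp [hL, hM, hE'.length]) hR]
      exact ⟨F', rfl, hF'⟩
  · rw [diagramColors_pair, show L ++ (E ++ (M ++ (F ++ R))) = L ++ E ++ M ++ F ++ R by simp]
    simp only [slice_colors_iff t (l := l ++ e.src ++ m) (r := r) f (L := L ++ E ++ M) (R := R) F _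
      (by simp [hL, hE, hM]) hR]
    symm
    constructor
    · rintro ⟨_, ⟨F', rfl, hF'⟩, h⟩
      rw [show L ++ E ++ M ++ F' ++ R = L ++ E ++ (M ++ F' ++ R) by simp,
        slice_colors_iff t e E c hL (by simp [hR, hM, hF'.length])] at h
      obtain ⟨E', rfl, hE'⟩ := h
      exact ⟨E', F', by simp, hE', hF'⟩
    · rintro ⟨E', F', rfl, hE', hF'⟩
      refine ⟨_, ⟨F', rfl, hF'⟩, ?_⟩
      rw [show L ++ E ++ M ++ F' ++ R = L ++ E ++ (M ++ F' ++ R) by simp,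
        slice_colors_iff t e E _ hL (by simp [hR, hM, hF'.length])]
      exact ⟨E', by simp, hE'⟩

theorem diagramColors_zigzag (ε : Bool) (ha : a.length = l.length + (r.length + 1)) :
    DiagramColors t [⟨l ++ [ε], .cup (!ε), r⟩, ⟨l, .cap ε, [ε] ++ r⟩] a c ↔
      DiagramColors t [] a c := by
  obtain ⟨L, R, x, rfl, hL, hR⟩ := exists_append_cons_of_length_eq ha
  simp only [diagramColors_pair, diagramColors_nil, colors_cup_succ hL hR]
  constructor
  · rintro ⟨_, ⟨y, rfl⟩, h⟩
    rw [colors_cap hL (by simp [hR])] at h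
    obtain ⟨rfl, rfl⟩ := h; rfl
  · rintro rfl
    exact ⟨_, ⟨x, rfl⟩, by rw [colors_cap hL (by simp [hR])]; simp⟩

theorem diagramColors_zagzig (ε : Bool) (ha : a.length = l.length + (r.length + 1)) :
    DiagramColors t [⟨l, .cup ε, [ε] ++ r⟩, ⟨l ++ [ε], .cap (!ε), r⟩] a c ↔
      DiagramColors t [] a c := by
  obtain ⟨L, R, x, rfl, hL, hR⟩ := exists_append_cons_of_length_eq ha
  have hR' : (x :: R).length = ([ε] ++ r).length := by simp [hR]
  simp only [diagramColors_pair, diagramColors_nil, colors_cup hL hR']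
  constructor
  · rintro ⟨_, ⟨y, rfl⟩, h⟩
    rw [colors_cap_succ hL hR] at h
    obtain ⟨rfl, rfl⟩ := h; rfl
  · rintro rfl
    exact ⟨_, ⟨x, rfl⟩, by rw [colors_cap_succ hL hR]; simp⟩

/-- If the sliding strand is over, both sides agree term by term. If it is under, the maximum
demands that two differences agree up to the factor `slope t δ` on one side and up to its inverse,
on the other leg, on the other side; these equations are equivalent. -/
theorem diagramColors_slideCap (ht : t ≠ 0) (ε δ o : Bool)
    (ha : a.length = l.length + (r.length + 3)) :
    DiagramColors t [⟨l ++ [ε], .crossing δ (!ε) o, r⟩, ⟨l, .cap ε, [δ] ++ r⟩] a c ↔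
      DiagramColors t [⟨l, .crossing ε δ (!o), [!ε] ++ r⟩, ⟨l ++ [δ], .cap ε, r⟩] a c := by
  obtain ⟨L, R, x, y, z, rfl, hL, hR⟩ := exists_append_cons₃_of_length_eq ha
  have hR' (x : K) (ε : Bool) : (x :: R).length = ([ε] ++ r).length := by simp [hR]
  cases o <;>
  simp only [diagramColors_pair, colors_crossing_true_succ hL hR, colors_crossing_false_succ hL hR,
    colors_crossing_true hL (hR' _ _), colors_crossing_false hL (hR' _ _), exists_eq_left,
    colors_cap hL (hR' _ _), colors_cap_succ hL hR, Bool.not_true, Bool.not_false, Bool.not_not,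
    and_congr_left_iff]
  · rintro -
    have := slope_ne_zero ht δ
    rw [slope_not]
    constructor
    · rintro rfl; field_simp; ring
    · rintro rfl; field_simp; ring
  · constructor
    · rintro ⟨rfl, rfl⟩; simp
    · rintro ⟨rfl, rfl⟩; simp

theorem diagramColors_slideCup (ht : t ≠ 0) (ε δ o : Bool)
    (ha : a.length = l.length + (r.length + 1)) :
    DiagramColors t [⟨l, .cup ε, [δ] ++ r⟩, ⟨l ++ [ε], .crossing (!ε) δ o, r⟩] a c ↔
      DiagramColors t [⟨l ++ [δ], .cup ε, r⟩, ⟨l, .crossing δ ε (!o), [!ε] ++ r⟩] a c := by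
  obtain ⟨L, R, x, rfl, hL, hR⟩ := exists_append_cons_of_length_eq ha
  have hR' (x : K) (ε : Bool) : (x :: R).length = ([ε] ++ r).length := by simp [hR]
  cases o <;>
  simp only [diagramColors_pair, colors_cup hL (hR' _ _), colors_cup_succ hL hR,
    exists_eq_exists_and, colors_crossing_true_succ hL hR, colors_crossing_false_succ hL hR,
    colors_crossing_true hL (hR' _ _), colors_crossing_false hL (hR' _ _), Bool.not_true,
    Bool.not_false, Bool.not_not]
  · have := slope_ne_zero ht δ
    rw [slope_not]
    constructor
    · rintro ⟨y, rfl⟩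
      -- The sliding strand is under here, so the two legs of the minimum have different colours at
      -- the top. On the other side of the move the free colour is that of the opposite leg.
      refine ⟨x + slope t δ * (y - x), ?_⟩
      simp [this]
    · rintro ⟨y, rfl⟩
      refine ⟨x + (slope t δ)⁻¹ * (y - x), ?_⟩
      simp [this]

theorem diagramColors_reidemeister₁Right (ht : t ≠ 0) (ε o : Bool)
    (ha : a.length = l.length + (r.length + 1)) :
    DiagramColors t [⟨l ++ [ε], .cup ε, r⟩, ⟨l, .crossing ε ε o, [!ε] ++ r⟩,
      ⟨l ++ [ε], .cap ε, r⟩] a c ↔ DiagramColors t [] a c := by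
  obtain ⟨L, R, x, rfl, hL, hR⟩ := exists_append_cons_of_length_eq ha
  have hR' (x : K) (ε : Bool) : (x :: R).length = ([ε] ++ r).length := by simp [hR]
  cases o <;>
  simp only [diagramColors_triple, diagramColors_nil, colors_cup_succ hL hR,
    exists_eq_exists_and, colors_crossing_true hL (hR' _ _), colors_crossing_false hL (hR' _ _),
    exists_eq_left, colors_cap_succ hL hR]
  · simp
  · have := slope_ne_zero ht ε
    constructor
    · rintro ⟨y, hy, rfl⟩
      -- Closing the curl gives `slope t ε * (x - y) = 0`.
      have : x = y := by grind
      rw [this]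
    · rintro rfl; exact ⟨x, by simp⟩

theorem diagramColors_reidemeister₁Left (ht : t ≠ 0) (ε o : Bool)
    (ha : a.length = l.length + (r.length + 1)) :
    DiagramColors t [⟨l, .cup (!ε), [ε] ++ r⟩, ⟨l ++ [!ε], .crossing ε ε o, r⟩,
      ⟨l, .cap (!ε), [ε] ++ r⟩] a c ↔ DiagramColors t [] a c := by
  obtain ⟨L, R, x, rfl, hL, hR⟩ := exists_append_cons_of_length_eq ha
  have hR' (x : K) (ε : Bool) : (x :: R).length = ([ε] ++ r).length := by simp [hR]
  cases o <;>
  simp only [diagramColors_triple, diagramColors_nil, colors_cup hL (hR' _ _),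
    exists_eq_exists_and, colors_crossing_true_succ hL hR, colors_crossing_false_succ hL hR,
    exists_eq_left, colors_cap hL (hR' _ _)]
  · have := slope_ne_zero ht (!ε)
    constructor
    · rintro ⟨y, hy, rfl⟩
      have : x = y := by grind
      rw [this]
    · rintro rfl; exact ⟨x, by simp⟩
  · simp

theorem diagramColors_reidemeister₂ (ht : t ≠ 0) (ε δ o : Bool)
    (ha : a.length = l.length + (r.length + 2)) :
    DiagramColors t [⟨l, .crossing ε δ o, r⟩, ⟨l, .crossing δ ε (!o), r⟩] a c ↔
      DiagramColors t [] a c := by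
  obtain ⟨L, R, x, y, rfl, hL, hR⟩ := exists_append_cons₂_of_length_eq ha
  cases o <;>
  simp only [diagramColors_pair, diagramColors_nil, colors_crossing_true hL hR,
    colors_crossing_false hL hR, exists_eq_left, Bool.not_true, Bool.not_false]
  · have := slope_ne_zero ht ε
    rw [slope_not]
    simp [this]
  · have := slope_ne_zero ht δ
    rw [slope_not]
    simp [this]

theorem diagramColors_reidemeister₃ (ht : t ≠ 0) (ε δ ζ u v w : Bool) (h : u = w → v = u)
    (ha : a.length = l.length + (r.length + 3)) :
    DiagramColors t [⟨l, .crossing ε δ u, [ζ] ++ r⟩, ⟨l ++ [δ], .crossing ε ζ v, r⟩,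
      ⟨l, .crossing δ ζ w, [ε] ++ r⟩] a c ↔
    DiagramColors t [⟨l ++ [ε], .crossing δ ζ w, r⟩, ⟨l, .crossing ε ζ v, [δ] ++ r⟩,
      ⟨l ++ [ζ], .crossing ε δ u, r⟩] a c := by
  obtain ⟨L, R, x, y, z, rfl, hL, hR⟩ := exists_append_cons₃_of_length_eq ha
  have hR' (x : K) (ε : Bool) : (x :: R).length = ([ε] ++ r).length := by simp [hR]
  -- Without extrema the top word is a function of the bottom word; it remains to compare its three
  -- new entries on the two sides.
  suffices ∃ d e f d' e' f', (DiagramColors t [⟨l, .crossing ε δ u, [ζ] ++ r⟩,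
        ⟨l ++ [δ], .crossing ε ζ v, r⟩, ⟨l, .crossing δ ζ w, [ε] ++ r⟩] (L ++ x :: y :: z :: R) c ↔
          c = L ++ d :: e :: f :: R) ∧
      (DiagramColors t [⟨l ++ [ε], .crossing δ ζ w, r⟩, ⟨l, .crossing ε ζ v, [δ] ++ r⟩,
        ⟨l ++ [ζ], .crossing ε δ u, r⟩] (L ++ x :: y :: z :: R) c ↔
          c = L ++ d' :: e' :: f' :: R) ∧ d = d' ∧ e = e' ∧ f = f' by
    obtain ⟨d, e, f, d', e', f', h, h', rfl, rfl, rfl⟩ := this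
    rw [h, h']
  -- The hypothesis removes the two cyclic choices; six height orders remain.
  cases u <;> cases v <;> cases w <;> first | (simp at h; done) | skip
  all_goals
    simp only [diagramColors_triple, colors_crossing_true_succ hL hR,
      colors_crossing_false_succ hL hR, colors_crossing_true hL (hR' _ _),
      colors_crossing_false hL (hR' _ _), exists_eq_left]
    refine ⟨_, _, _, _, _, _, Iff.rfl, Iff.rfl, ?_, ?_, ?_⟩
  all_goals clear ha hL hR hR' h
  all_goals
    have h₁ := slope_ne_zero ht ε
    have h₂ := slope_ne_zero ht δ
    have h₃ := slope_ne_zero ht ζ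
    try simp only [slope_not]
  all_goals
    -- The identities hold for arbitrary nonzero factors, so the orientations need not be
    -- distinguished.
    generalize slope t ε = p at *
    generalize slope t δ = q at *
    generalize slope t ζ = s at *
    field_simp
  all_goals ring

/-- A local move does not change the pairs of words of colours at the bottom and at the top which
extend to a colouring. -/
theorem LocalMove.diagramColors_iff (ht : t ≠ 0) {X X' : List Slice} (h : LocalMove X X')
    {s s' : List Bool} (hX : IsTangleDiagram s X s') (ha : a.length = s.length) :
    DiagramColors t X a c ↔ DiagramColors t X' a c := by
  cases h with
  | exchange l m r e f =>
    obtain ⟨rfl, -⟩ := hX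
    exact diagramColors_exchange l r c m e f (by simp [ha, Slice.src, add_assoc])
  | zigzag l r ε =>
    obtain ⟨rfl, -⟩ := hX
    exact diagramColors_zigzag l r c ε (by simp [ha, Slice.src, Piece.src])
  | zagzig l r ε =>
    obtain ⟨rfl, -⟩ := hX
    exact diagramColors_zagzig l r c ε (by simp [ha, Slice.src, Piece.src])
  | slideCap l r ε δ o =>
    obtain ⟨rfl, -⟩ := hX
    exact diagramColors_slideCap l r c ht ε δ o (by simp [ha, Slice.src, Piece.src])
  | slideCup l r ε δ o =>
    obtain ⟨rfl, -⟩ := hX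
    exact diagramColors_slideCup l r c ht ε δ o (by simp [ha, Slice.src, Piece.src])
  | reidemeister₁Right l r ε o =>
    obtain ⟨rfl, -⟩ := hX
    exact diagramColors_reidemeister₁Right l r c ht ε o (by simp [ha, Slice.src, Piece.src])
  | reidemeister₁Left l r ε o =>
    obtain ⟨rfl, -⟩ := hX
    exact diagramColors_reidemeister₁Left l r c ht ε o (by simp [ha, Slice.src, Piece.src])
  | reidemeister₂ l r ε δ o =>
    obtain ⟨rfl, -⟩ := hX
    exact diagramColors_reidemeister₂ l r c ht ε δ o (by simp [ha, Slice.src, Piece.src])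
  | reidemeister₃ l r ε δ ζ u v w h =>
    obtain ⟨rfl, -⟩ := hX
    exact diagramColors_reidemeister₃ l r c ht ε δ ζ u v w h
      (by simp [ha, Slice.src, Piece.src])

theorem StringLinkDiagram.Move.diagramColors_iff (ht : t ≠ 0) {n : ℕ} {D D' : StringLinkDiagram n}
    (h : D.Move D') (ha : a.length = n) :
    DiagramColors t D.slices a c ↔ DiagramColors t D'.slices a c := by
  obtain ⟨A, X, X', B, hX, hD, hD'⟩ := h
  have hT := D.isTangleDiagram
  rw [hD, List.append_assoc, isTangleDiagram_append] at hT
  obtain ⟨w, hA, hT⟩ := hT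
  rw [isTangleDiagram_append] at hT
  obtain ⟨w', hX', -⟩ := hT
  simp only [hD, hD', List.append_assoc, diagramColors_append]
  refine exists_congr fun b => and_congr_right fun hb => exists_congr fun b' => ?_
  rw [hX.diagramColors_iff b' ht hX' (hb.length hA (by simp [plusWord, ha]))]

end Moves

/-! ### The constant colouring and the conserved flow -/

section Flow

variable {K : Type*} [Field K] {t : K}

/-- All differences at crossings vanish; equivalently, the weights of going straight on and of
dropping add up to one. This is the source of `e γ = e`. -/
theorem DiagramColors.ones {D : List Slice} {s s' : List Bool} (h : IsTangleDiagram s D s') :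
    DiagramColors t D (List.replicate s.length 1) (List.replicate s'.length 1) := by
  induction D generalizing s with
  | nil => cases h; rfl
  | cons x D ih =>
    obtain ⟨rfl, h⟩ := h
    refine ⟨_, ⟨List.replicate x.left.length 1, List.replicate x.piece.src.length 1,
      List.replicate x.piece.tgt.length 1, List.replicate x.right.length 1, by simp, by simp,
      by simp [Slice.src, add_assoc], ?_, ?_⟩, ih h⟩
    · simp [Slice.tgt, add_assoc]
    · rcases x.piece with ⟨ε, δ, _ | _⟩ | ε | ε <;>
        simp [Piece.Colors, Piece.src, Piece.tgt, List.replicate]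

/-- The factor by which the weights of the strands to the right of a word of signs are
multiplied. -/
def wordFactor (t : K) (w : List Bool) : K := (w.map fun ε => if ε then t else t⁻¹).prod

/-- The total flow through a horizontal line with given signs and colours: an upward strand
contributes its colour times `t ^ k` and a downward one minus its colour times `t ^ (k - 1)`, where
`k` is the number of upward strands minus the number of downward strands to the left of it. -/
def flow (t : K) : List Bool → List K → K
  | true :: w, x :: a => x + t * flow t w a
  | false :: w, x :: a => -(t⁻¹ * x) + t⁻¹ * flow t w a
  | _, _ => 0

theorem flow_append {v w : List Bool} {a b : List K} (h : a.length = v.length) :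
    flow t (v ++ w) (a ++ b) = flow t v a + wordFactor t v * flow t w b := by
  induction v generalizing a with
  | nil => obtain rfl := List.length_eq_zero_iff.1 h; simp [flow, wordFactor]
  | cons ε v ih =>
    obtain ⟨x, a, rfl⟩ := List.exists_cons_of_length_eq_add_one h
    have := ih (a := a) (by simpa using h)
    cases ε <;> simp only [List.cons_append, flow, this, wordFactor, List.map_cons, List.prod_cons,
      if_true, Bool.false_eq_true, if_false] <;> ring

/-- A piece preserves the number of upward minus downward strands, so the strands to its right keep
their weights in the flow. -/
theorem Piece.wordFactor_eq (ht : t ≠ 0) (e : Piece) : wordFactor t e.src = wordFactor t e.tgt := by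
  rcases e with ⟨ε, δ, o⟩ | ε | ε
  · simp [wordFactor, Piece.src, Piece.tgt, mul_comm]
  · cases ε <;> simp [wordFactor, Piece.src, Piece.tgt, ht]
  · cases ε <;> simp [wordFactor, Piece.src, Piece.tgt, ht]

/-- For two upward strands with the first one over this is `a + t * b = b + t * (b + t⁻¹ * (a -
b))`. At an extremum the two ends have the same colour and opposite weights. -/
theorem Piece.Colors.flow_eq (ht : t ≠ 0) {e : Piece} {p q : List K} (h : e.Colors t p q) :
    flow t e.src p = flow t e.tgt q := by
  rcases e with ⟨ε, δ, _ | _⟩ | ε | ε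
  · obtain ⟨a, b, rfl, rfl⟩ := h
    cases ε <;> cases δ <;> simp [Piece.src, Piece.tgt, flow, slope] <;> field_simp <;> ring
  · obtain ⟨a, b, rfl, rfl⟩ := h
    cases ε <;> cases δ <;> simp [Piece.src, Piece.tgt, flow, slope] <;> field_simp <;> ring
  · obtain ⟨rfl, a, rfl⟩ := h
    cases ε <;> simp [Piece.src, Piece.tgt, flow, ht]
  · obtain ⟨rfl, a, rfl⟩ := h
    cases ε <;> simp [Piece.src, Piece.tgt, flow, ht]

theorem Slice.Colors.flow_eq (ht : t ≠ 0) {x : Slice} {a b : List K} (h : x.Colors t a b) :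
    flow t x.src a = flow t x.tgt b := by
  obtain ⟨l, p, q, r, hl, hr, rfl, rfl, h⟩ := h
  simp only [Slice.src, Slice.tgt, List.append_assoc]
  rw [flow_append hl, flow_append hl, flow_append h.length.1, flow_append h.length.2,
    h.flow_eq ht, x.piece.wordFactor_eq ht]

theorem DiagramColors.flow_eq (ht : t ≠ 0) {D : List Slice} {s s' : List Bool} {a c : List K}
    (hD : IsTangleDiagram s D s') (h : DiagramColors t D a c) : flow t s a = flow t s' c := by
  induction D generalizing s a with
  | nil => cases hD; cases h; rfl
  | cons x D ih =>
    obtain ⟨rfl, hD⟩ := hD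
    obtain ⟨b, hb, h⟩ := h
    rw [hb.flow_eq ht, ih hD h]

theorem flow_plusWord {n : ℕ} (f : Fin n → K) :
    flow t (plusWord n) (List.ofFn f) = ∑ i : Fin n, t ^ (i : ℕ) * f i := by
  induction n with
  | zero => simp [plusWord, flow]
  | succ n ih =>
    have := ih (fun i => f i.succ)
    simp only [plusWord] at this
    simp [plusWord, List.replicate_succ, List.ofFn_succ, flow, this, Fin.sum_univ_succ,
      Finset.mul_sum, pow_succ', mul_assoc]

end Flow

/-! ### One step of the random walk -/

section Branching

variable {α β : Type*}

/-- The possible sets of continuations of an admissible path at a point: there is only one, or one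
may go straight on along an overcrossing strand or drop from it. -/
inductive IsBranching : Set (Passage × α) → Prop
  | plain (b : α) : IsBranching {(.plain, b)}
  | under (b : α) : IsBranching {(.under, b)}
  | split (s : Bool) (b b' : α) : IsBranching {(.over s, b), (.drop s, b')}

theorem IsBranching.image {S : Set (Passage × α)} (h : IsBranching S) (f : α → β) :
    IsBranching (Prod.map id f '' S) := by
  cases h with
  | plain b => rw [Set.image_singleton]; exact .plain _
  | under b => rw [Set.image_singleton]; exact .under _
  | split s b b' => rw [Set.image_pair]; exact .split _ _ _

theorem IsBranching.nonempty {S : Set (Passage × α)} (h : IsBranching S) : S.Nonempty := by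
  cases h <;> simp

theorem IsBranching.finite {S : Set (Passage × α)} (h : IsBranching S) : S.Finite := by
  cases h <;> simp

/-- The expected value of `u` after one of the continuations in `S`. -/
noncomputable def mean (t : ℝ) (u : α → ℝ) (S : Set (Passage × α)) : ℝ :=
  ∑' y : S, y.1.1.weight t * u y.1.2

theorem mean_plain (t : ℝ) (u : α → ℝ) (b : α) : mean t u {(.plain, b)} = u b := by
  rw [mean, tsum_singleton (Passage.plain, b) fun y : Passage × α => y.1.weight t * u y.2]
  simp [Passage.weight]

theorem mean_under (t : ℝ) (u : α → ℝ) (b : α) : mean t u {(.under, b)} = u b := by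
  rw [mean, tsum_singleton (Passage.under, b) fun y : Passage × α => y.1.weight t * u y.2]
  simp [Passage.weight]

theorem tsum_pair {α : Type*} {a b : α} (h : a ≠ b) (f : α → ℝ) :
    ∑' y : ({a, b} : Set α), f y = f a + f b := by
  classical
  have : ({a, b} : Set α) = (({a, b} : Finset α) : Set α) := by simp
  rw [this, Finset.tsum_subtype' _ f, Finset.sum_pair h]

theorem mean_split (t : ℝ) (u : α → ℝ) (s : Bool) (b b' : α) :
    mean t u {(.over s, b), (.drop s, b')} =
      (if s then t else t⁻¹) * u b + (1 - if s then t else t⁻¹) * u b' := by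
  rw [mean, tsum_pair (a := (Passage.over s, b)) (b := (Passage.drop s, b')) (by simp)
    fun y => y.1.weight t * u y.2]
  cases s <;> simp [Passage.weight]

/-- Injectivity of `f` is not needed: the kinds of passage already distinguish the two
continuations. -/
theorem IsBranching.mean_image {S : Set (Passage × α)} (h : IsBranching S) (t : ℝ) (f : α → β)
    (u : β → ℝ) : mean t u (Prod.map id f '' S) = mean t (u ∘ f) S := by
  cases h <;> simp [Set.image_pair, mean_plain, mean_under, mean_split]

end Branching

/-! ### Passages through a piece and harmonicity there -/

section Ports

/-- An oriented strand with sign word `s` at the bottom and `s'` at the top enters at this port. -/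
def IsEntry (s s' : List Bool) : Port → Prop
  | .bot p => s[p]? = some true
  | .top p => s'[p]? = some false

/-- An oriented strand with sign word `s` at the bottom and `s'` at the top leaves at this port. -/
def IsExit (s s' : List Bool) : Port → Prop
  | .bot p => s[p]? = some false
  | .top p => s'[p]? = some true

theorem isEntry_entry {s s' : List Bool} {p q : ℕ} {ε : Bool} (h : s[p]? = some ε)
    (h' : s'[q]? = some ε) : IsEntry s s' (entry ε (.bot p) (.top q)) := by
  cases ε <;> simpa [entry, IsEntry]

theorem isExit_leave {s s' : List Bool} {p q : ℕ} {ε : Bool} (h : s[p]? = some ε)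
    (h' : s'[q]? = some ε) : IsExit s s' (leave ε (.bot p) (.top q)) := by
  cases ε <;> simpa [leave, IsExit]

theorem isEntry_crossing_iff (ε δ : Bool) (a : Port) : IsEntry [ε, δ] [δ, ε] a ↔
    a = entry ε (.bot 0) (.top 1) ∨ a = entry δ (.bot 1) (.top 0) := by
  rcases a with (_ | _ | p) | (_ | _ | p) <;> cases ε <;> cases δ <;> simp [IsEntry, entry]

theorem isEntry_cup_iff (ε : Bool) (a : Port) :
    IsEntry [] [ε, !ε] a ↔ a = entry ε (.top 1) (.top 0) := by
  rcases a with (_ | _ | p) | (_ | _ | p) <;> cases ε <;> simp [IsEntry, entry]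

theorem isEntry_cap_iff (ε : Bool) (a : Port) :
    IsEntry [ε, !ε] [] a ↔ a = entry ε (.bot 0) (.bot 1) := by
  rcases a with (_ | _ | p) | (_ | _ | p) <;> cases ε <;> simp [IsEntry, entry]

theorem Piece.Pass.isEntry {e : Piece} {a b : Port} {k : Passage} (h : e.Pass a b k) :
    IsEntry e.src e.tgt a := by
  cases h <;> simp [Piece.src, Piece.tgt, isEntry_crossing_iff, isEntry_cup_iff, isEntry_cap_iff]

theorem Piece.Pass.isExit {e : Piece} {a b : Port} {k : Passage} (h : e.Pass a b k) :
    IsExit e.src e.tgt b := by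
  have key (ε δ : Bool) : IsExit [ε, δ] [δ, ε] (leave ε (.bot 0) (.top 1)) ∧
      IsExit [ε, δ] [δ, ε] (leave δ (.bot 1) (.top 0)) := by
    cases ε <;> cases δ <;> simp [IsExit, leave]
  cases h with
  | cup ε => cases ε <;> simp [Piece.tgt, IsExit, leave]
  | cap ε => cases ε <;> simp [Piece.src, IsExit, leave]
  | _ => simp [Piece.src, Piece.tgt, key]

/-- The passages of a piece that start at the port `a`. -/
def Piece.passes (e : Piece) (a : Port) : Set (Passage × Port) := {y | e.Pass a y.2 y.1}

theorem passes_over₁ (ε δ : Bool) :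
    (Piece.crossing ε δ true).passes (entry ε (.bot 0) (.top 1)) =
      {(.over (isPositive ε δ true), leave ε (.bot 0) (.top 1)),
        (.drop (isPositive ε δ true), leave δ (.bot 1) (.top 0))} := by
  ext ⟨k, b⟩
  constructor
  · intro h
    simp only [Piece.passes, Set.mem_ofPred_eq] at h
    -- `entry ε _ _` is not a constructor, so the port must become a variable before `cases` can
    -- match it with the passages; the third one is excluded because the two strands enter at
    -- different ports.
    generalize ha : entry ε (.bot 0) (.top 1) = a at h
    cases h
    · simp
    · simp
    · cases ε <;> cases δ <;> simp [entry] at ha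
  · rintro (h | h)
    · cases h; exact .over₁ ..
    · cases h; exact .drop₁ ..

theorem passes_under₁ (ε δ : Bool) :
    (Piece.crossing ε δ true).passes (entry δ (.bot 1) (.top 0)) =
      {(.under, leave δ (.bot 1) (.top 0))} := by
  ext ⟨k, b⟩
  constructor
  · intro h
    simp only [Piece.passes, Set.mem_ofPred_eq] at h
    generalize ha : entry δ (.bot 1) (.top 0) = a at h
    cases h
    · cases ε <;> cases δ <;> simp [entry] at ha
    · cases ε <;> cases δ <;> simp [entry] at ha
    · simp
  · intro h; cases h; exact .under₁ ..

theorem passes_over₂ (ε δ : Bool) :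
    (Piece.crossing ε δ false).passes (entry δ (.bot 1) (.top 0)) =
      {(.over (isPositive ε δ false), leave δ (.bot 1) (.top 0)),
        (.drop (isPositive ε δ false), leave ε (.bot 0) (.top 1))} := by
  ext ⟨k, b⟩
  constructor
  · intro h
    simp only [Piece.passes, Set.mem_ofPred_eq] at h
    generalize ha : entry δ (.bot 1) (.top 0) = a at h
    cases h
    · simp
    · simp
    · cases ε <;> cases δ <;> simp [entry] at ha
  · rintro (h | h)
    · cases h; exact .over₂ ..
    · cases h; exact .drop₂ ..

theorem passes_under₂ (ε δ : Bool) :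
    (Piece.crossing ε δ false).passes (entry ε (.bot 0) (.top 1)) =
      {(.under, leave ε (.bot 0) (.top 1))} := by
  ext ⟨k, b⟩
  constructor
  · intro h
    simp only [Piece.passes, Set.mem_ofPred_eq] at h
    generalize ha : entry ε (.bot 0) (.top 1) = a at h
    cases h
    · cases ε <;> cases δ <;> simp [entry] at ha
    · cases ε <;> cases δ <;> simp [entry] at ha
    · simp
  · intro h; cases h; exact .under₂ ..

theorem passes_cup (ε : Bool) : (Piece.cup ε).passes (entry ε (.top 1) (.top 0)) =
    {(.plain, leave ε (.top 1) (.top 0))} := by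
  ext ⟨k, b⟩
  constructor
  · intro h
    simp only [Piece.passes, Set.mem_ofPred_eq] at h
    generalize entry ε (.top 1) (.top 0) = a at h
    cases h; simp
  · intro h; cases h; exact .cup ..

theorem passes_cap (ε : Bool) : (Piece.cap ε).passes (entry ε (.bot 0) (.bot 1)) =
    {(.plain, leave ε (.bot 0) (.bot 1))} := by
  ext ⟨k, b⟩
  constructor
  · intro h
    simp only [Piece.passes, Set.mem_ofPred_eq] at h
    generalize entry ε (.bot 0) (.bot 1) = a at h
    cases h; simp
  · intro h; cases h; exact .cap ..

theorem Piece.isBranching_passes {e : Piece} {a : Port} (h : IsEntry e.src e.tgt a) :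
    IsBranching (e.passes a) := by
  rcases e with ⟨ε, δ, _ | _⟩ | ε | ε
  · rcases (isEntry_crossing_iff ε δ a).1 h with rfl | rfl
    · rw [passes_under₂]; exact .under _
    · rw [passes_over₂]; exact .split ..
  · rcases (isEntry_crossing_iff ε δ a).1 h with rfl | rfl
    · rw [passes_over₁]; exact .split ..
    · rw [passes_under₁]; exact .under _
  · rw [(isEntry_cup_iff ε a).1 h, passes_cup]; exact .plain _
  · rw [(isEntry_cap_iff ε a).1 h, passes_cap]; exact .plain _

/-- The colour at a port, given the words of colours at the bottom and at the top. -/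
def portColor (a b : List ℝ) : Port → ℝ
  | .bot p => a.getD p 0
  | .top p => b.getD p 0

/-- Harmonicity is a relation along the orientations, whereas `Piece.Colors` computes upwards. They
agree because the weight on the overcrossing strand is invertible and solving for the exit instead
of the entry inverts it. -/
theorem Piece.colors_iff {t : ℝ} (ht : t ≠ 0) {e : Piece} {p q : List ℝ}
    (hp : p.length = e.src.length) (hq : q.length = e.tgt.length) :
    e.Colors t p q ↔ ∀ a, IsEntry e.src e.tgt a →
      portColor p q a = mean t (portColor p q) (e.passes a) := by
  rcases e with ⟨ε, δ, _ | _⟩ | ε | ε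
  · obtain ⟨a, b, rfl⟩ := List.length_eq_two.1 hp
    obtain ⟨c, d, rfl⟩ := List.length_eq_two.1 hq
    simp only [Piece.src, Piece.tgt, isEntry_crossing_iff, forall_eq_or_imp, forall_eq,
      passes_over₂, passes_under₂, mean_split, mean_under, Piece.Colors]
    cases ε <;> cases δ <;> simp [entry, leave, portColor, isPositive, slope] <;> grind
  · obtain ⟨a, b, rfl⟩ := List.length_eq_two.1 hp
    obtain ⟨c, d, rfl⟩ := List.length_eq_two.1 hq
    simp only [Piece.src, Piece.tgt, isEntry_crossing_iff, forall_eq_or_imp, forall_eq,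
      passes_over₁, passes_under₁, mean_split, mean_under, Piece.Colors]
    cases ε <;> cases δ <;> simp [entry, leave, portColor, isPositive, slope] <;> grind
  · obtain rfl := List.length_eq_zero_iff.1 hp
    obtain ⟨c, d, rfl⟩ := List.length_eq_two.1 hq
    simp only [Piece.src, Piece.tgt, isEntry_cup_iff, forall_eq, passes_cup, mean_plain,
      Piece.Colors]
    cases ε <;>
      · simp [entry, leave, portColor]
        try grind
  · obtain rfl := List.length_eq_zero_iff.1 hq
    obtain ⟨c, d, rfl⟩ := List.length_eq_two.1 hp
    simp only [Piece.src, Piece.tgt, isEntry_cap_iff, forall_eq, passes_cap, mean_plain,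
      Piece.Colors]
    cases ε <;>
      · simp [entry, leave, portColor]
        try grind

end Ports

/-! ### Harmonicity in a slice -/

section SlicePorts

variable {x : Slice}

theorem Slice.getElem?_src_left {p : ℕ} {ε : Bool} (h : x.left[p]? = some ε) :
    x.src[p]? = some ε := by
  have := (List.getElem?_eq_some_iff.1 h).1
  rw [Slice.src, List.append_assoc, List.getElem?_append_left this, h]

theorem Slice.getElem?_tgt_left {p : ℕ} {ε : Bool} (h : x.left[p]? = some ε) :
    x.tgt[p]? = some ε := by
  have := (List.getElem?_eq_some_iff.1 h).1
  rw [Slice.tgt, List.append_assoc, List.getElem?_append_left this, h]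

theorem Slice.getElem?_src_right (x : Slice) (p : ℕ) :
    x.src[x.left.length + x.piece.src.length + p]? = x.right[p]? := by
  rw [Slice.src, List.getElem?_append_right (by simp)]; simp

theorem Slice.getElem?_tgt_right (x : Slice) (p : ℕ) :
    x.tgt[x.left.length + x.piece.tgt.length + p]? = x.right[p]? := by
  rw [Slice.tgt, List.getElem?_append_right (by simp)]; simp

theorem Slice.getElem?_src_piece {p : ℕ} {ε : Bool} (h : x.piece.src[p]? = some ε) :
    x.src[x.left.length + p]? = some ε := by
  have := (List.getElem?_eq_some_iff.1 h).1
  rw [Slice.src, List.append_assoc, List.getElem?_append_right (by simp),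
    List.getElem?_append_left (by simpa using this)]
  simpa using h

theorem Slice.getElem?_tgt_piece {p : ℕ} {ε : Bool} (h : x.piece.tgt[p]? = some ε) :
    x.tgt[x.left.length + p]? = some ε := by
  have := (List.getElem?_eq_some_iff.1 h).1
  rw [Slice.tgt, List.append_assoc, List.getElem?_append_right (by simp),
    List.getElem?_append_left (by simpa using this)]
  simpa using h

theorem isEntry_shift {a : Port} (h : IsEntry x.piece.src x.piece.tgt a) :
    IsEntry x.src x.tgt (a.shift x.left.length) := by
  cases a
  · exact Slice.getElem?_src_piece h
  · exact Slice.getElem?_tgt_piece h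

theorem isExit_shift {a : Port} (h : IsExit x.piece.src x.piece.tgt a) :
    IsExit x.src x.tgt (a.shift x.left.length) := by
  cases a
  · exact Slice.getElem?_src_piece h
  · exact Slice.getElem?_tgt_piece h

theorem Slice.Pass.isEntry {a b : Port} {k : Passage} (h : x.Pass a b k) :
    IsEntry x.src x.tgt a := by
  cases h with
  | left p ε h => exact isEntry_entry (getElem?_src_left h) (getElem?_tgt_left h)
  | right p ε h =>
    exact isEntry_entry (by rw [getElem?_src_right, h]) (by rw [getElem?_tgt_right, h])
  | piece a b k h => exact isEntry_shift h.isEntry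

theorem Slice.Pass.isExit {a b : Port} {k : Passage} (h : x.Pass a b k) :
    IsExit x.src x.tgt b := by
  cases h with
  | left p ε h => exact isExit_leave (getElem?_src_left h) (getElem?_tgt_left h)
  | right p ε h =>
    exact isExit_leave (by rw [getElem?_src_right, h]) (by rw [getElem?_tgt_right, h])
  | piece a b k h => exact isExit_shift h.isExit

/-- The lower end of the `p`-th vertical strand to the right of the piece of a slice. -/
def Slice.rightBot (x : Slice) (p : ℕ) : Port := .bot (x.left.length + x.piece.src.length + p)

/-- The upper end of the `p`-th vertical strand to the right of the piece of a slice. -/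
def Slice.rightTop (x : Slice) (p : ℕ) : Port := .top (x.left.length + x.piece.tgt.length + p)

/-- The entries of a slice: those of the vertical strands and those of the piece. -/
theorem Slice.isEntry_cases {a : Port} (h : IsEntry x.src x.tgt a) :
    (∃ p ε, x.left[p]? = some ε ∧ a = entry ε (.bot p) (.top p)) ∨
    (∃ p ε, x.right[p]? = some ε ∧ a = entry ε (x.rightBot p) (x.rightTop p)) ∨
    ∃ b, IsEntry x.piece.src x.piece.tgt b ∧ a = b.shift x.left.length := by
  have key (m : List Bool) (p : ℕ) (ε : Bool) (h : (x.left ++ m ++ x.right)[p]? = some ε) :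
      x.left[p]? = some ε ∨ (∃ q, x.right[q]? = some ε ∧ p = x.left.length + m.length + q) ∨
      ∃ q, m[q]? = some ε ∧ p = x.left.length + q := by
    rw [List.getElem?_append, List.getElem?_append] at h
    split_ifs at h with h₁ h₂
    · exact .inl h
    · exact .inr (.inr ⟨_, h, by omega⟩)
    · exact .inr (.inl ⟨_, h, by simp at h₁ ⊢; omega⟩)
  rcases a with p | p
  · rcases key _ _ _ h with h | ⟨q, h', rfl⟩ | ⟨q, h', rfl⟩
    · exact .inl ⟨p, _, h, rfl⟩
    · exact .inr (.inl ⟨q, _, h', rfl⟩)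
    · exact .inr (.inr ⟨.bot q, h', rfl⟩)
  · rcases key _ _ _ h with h | ⟨q, h', rfl⟩ | ⟨q, h', rfl⟩
    · exact .inl ⟨p, _, h, rfl⟩
    · exact .inr (.inl ⟨q, _, h', rfl⟩)
    · exact .inr (.inr ⟨.top q, h', rfl⟩)

/-- The passages of a slice that start at the port `a`. -/
def Slice.passes (x : Slice) (a : Port) : Set (Passage × Port) := {y | x.Pass a y.2 y.1}

theorem Port.shift_injective (l : ℕ) : Function.Injective (Port.shift l) := by
  rintro (p | p) (q | q) <;> simp [Port.shift]

/-- Separates the ports of the piece from those of the vertical strands on either side. -/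
theorem IsEntry.shift_lt {e : Piece} {a : Port} (h : IsEntry e.src e.tgt a) (l : ℕ) :
    ∃ p, (a.shift l = .bot p ∧ l ≤ p ∧ p < l + e.src.length) ∨
      (a.shift l = .top p ∧ l ≤ p ∧ p < l + e.tgt.length) := by
  rcases a with p | p
  · exact ⟨l + p, .inl ⟨rfl, by simp, by simpa using (List.getElem?_eq_some_iff.1 h).1⟩⟩
  · exact ⟨l + p, .inr ⟨rfl, by simp, by simpa using (List.getElem?_eq_some_iff.1 h).1⟩⟩

theorem Slice.passes_left {p : ℕ} {ε : Bool} (h : x.left[p]? = some ε) :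
    x.passes (entry ε (.bot p) (.top p)) = {(.plain, leave ε (.bot p) (.top p))} := by
  have hp := (List.getElem?_eq_some_iff.1 h).1
  ext ⟨k, b⟩
  constructor
  · intro h'
    simp only [Slice.passes, Set.mem_ofPred_eq] at h'
    generalize ha : entry ε (.bot p) (.top p) = a at h'
    cases h' with
    | left q δ h' =>
      obtain rfl : p = q := by cases ε <;> cases δ <;> simp [entry] at ha <;> exact ha
      cases h.symm.trans h'; rfl
    | right q δ h' => cases ε <;> cases δ <;> simp [entry] at ha <;> omega
    | piece a b k h' =>
      obtain ⟨q, ⟨h₁, h₂, -⟩ | ⟨h₁, h₂, -⟩⟩ := h'.isEntry.shift_lt x.left.length <;>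
        rw [h₁] at ha <;> cases ε <;> simp [entry] at ha <;> omega
  · intro h'; cases h'; exact .left p ε h

theorem Slice.passes_right {p : ℕ} {ε : Bool} (h : x.right[p]? = some ε) :
    x.passes (entry ε (x.rightBot p) (x.rightTop p)) =
      {(.plain, leave ε (x.rightBot p) (x.rightTop p))} := by
  ext ⟨k, b⟩
  constructor
  · intro h'
    simp only [Slice.passes, Set.mem_ofPred_eq] at h'
    generalize ha : entry ε (x.rightBot p) (x.rightTop p) = a at h'
    cases h' with
    | left q δ h' =>
      have hq := (List.getElem?_eq_some_iff.1 h').1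
      cases ε <;> cases δ <;> simp [entry, rightBot, rightTop] at ha <;> omega
    | right q δ h' =>
      obtain rfl : p = q := by
        cases ε <;> cases δ <;> simp [entry, rightBot, rightTop] at ha <;> exact ha
      cases h.symm.trans h'; rfl
    | piece a b k h' =>
      obtain ⟨q, ⟨h₁, -, h₂⟩ | ⟨h₁, -, h₂⟩⟩ := h'.isEntry.shift_lt x.left.length <;>
        rw [h₁] at ha <;> cases ε <;> simp [entry, rightBot, rightTop] at ha <;> omega
  · intro h'; cases h'; exact .right p ε h

theorem Slice.passes_shift {a : Port} (h : IsEntry x.piece.src x.piece.tgt a) :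
    x.passes (a.shift x.left.length) =
      Prod.map id (Port.shift x.left.length) '' x.piece.passes a := by
  ext ⟨k, b⟩
  constructor
  · intro h'
    simp only [Slice.passes, Set.mem_ofPred_eq] at h'
    obtain ⟨p, hp⟩ := h.shift_lt x.left.length
    generalize ha : a.shift x.left.length = a' at h' hp
    cases h' with
    | left q δ h' =>
      have hq := (List.getElem?_eq_some_iff.1 h').1
      cases δ <;> simp [entry] at hp <;> omega
    | right q δ h' => cases δ <;> simp [entry] at hp <;> omega
    | piece a b k h' =>
      cases Port.shift_injective _ ha
      exact ⟨(k, b), h', rfl⟩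
  · rintro ⟨⟨k, b⟩, h', ⟨⟩⟩
    exact .piece _ _ _ h'

theorem Slice.isBranching_passes {a : Port} (h : IsEntry x.src x.tgt a) :
    IsBranching (x.passes a) := by
  rcases isEntry_cases h with ⟨p, ε, h', rfl⟩ | ⟨p, ε, h', rfl⟩ | ⟨b, h', rfl⟩
  · rw [passes_left h']; exact .plain _
  · rw [passes_right h']; exact .plain _
  · rw [passes_shift h']; exact (Piece.isBranching_passes h').image _

theorem portColor_append_shift {l p q r : List ℝ} {e : Piece} (hp : p.length = e.src.length)
    (hq : q.length = e.tgt.length) {a : Port}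
    (h : IsEntry e.src e.tgt a ∨ IsExit e.src e.tgt a) :
    portColor (l ++ p ++ r) (l ++ q ++ r) (a.shift l.length) = portColor p q a := by
  have key (p : List ℝ) (i : ℕ) (hi : i < p.length) :
      (l ++ p ++ r).getD (l.length + i) 0 = p.getD i 0 := by
    rw [List.append_assoc, List.getD_append_right _ _ _ _ (by simp),
      List.getD_append _ _ _ _ (by simpa using hi)]
    simp
  rcases a with i | i
  · refine key _ _ ?_
    rcases h with h | h <;> exact hp ▸ (List.getElem?_eq_some_iff.1 h).1
  · refine key _ _ ?_
    rcases h with h | h <;> exact hq ▸ (List.getElem?_eq_some_iff.1 h).1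

theorem mean_congr {α : Type*} {t : ℝ} {u v : α → ℝ} {S : Set (Passage × α)}
    (h : ∀ y ∈ S, u y.2 = v y.2) : mean t u S = mean t v S :=
  tsum_congr fun y => by rw [h y y.2]

theorem mean_portColor_append {t : ℝ} {l p q r : List ℝ} (hl : l.length = x.left.length)
    (hp : p.length = x.piece.src.length)
    (hq : q.length = x.piece.tgt.length) {a : Port} (h : IsEntry x.piece.src x.piece.tgt a) :
    mean t (portColor (l ++ p ++ r) (l ++ q ++ r)) (x.passes (a.shift x.left.length)) =
      mean t (portColor p q) (x.piece.passes a) := by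
  rw [Slice.passes_shift h, (Piece.isBranching_passes h).mean_image]
  refine mean_congr fun y hy => ?_
  rw [Function.comp_apply, ← hl]
  exact portColor_append_shift hp hq (.inr (Piece.Pass.isExit hy))

theorem entry_eq_leave_iff {ε : Bool} {a b : Port} (v : Port → ℝ) :
    v (entry ε a b) = v (leave ε a b) ↔ v a = v b := by
  cases ε <;> simp [entry, leave, eq_comm]

/-- Colours at the bottom and at the top of a slice fit together iff they are harmonic with respect
to the random walk. -/
theorem Slice.colors_iff {t : ℝ} (ht : t ≠ 0) {a b : List ℝ}
    (ha : a.length = x.src.length) (hb : b.length = x.tgt.length) :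
    x.Colors t a b ↔ ∀ c, IsEntry x.src x.tgt c →
      portColor a b c = mean t (portColor a b) (x.passes c) := by
  constructor
  · rintro ⟨l, p, q, r, hl, hr, rfl, rfl, h⟩ c hc
    rcases isEntry_cases hc with ⟨i, ε, hi, rfl⟩ | ⟨i, ε, hi, rfl⟩ | ⟨b, hb, rfl⟩
    · rw [passes_left hi, mean_plain, entry_eq_leave_iff]
      have := (List.getElem?_eq_some_iff.1 hi).1
      simp only [portColor, List.append_assoc]
      rw [List.getD_append _ _ _ _ (by omega), List.getD_append _ _ _ _ (by omega)]
    · rw [passes_right hi, mean_plain, entry_eq_leave_iff]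
      have := h.length
      simp only [portColor, rightBot, rightTop]
      rw [List.getD_append_right _ _ _ _ (by simp; omega),
        List.getD_append_right _ _ _ _ (by simp; omega)]
      congr 1
      simp; omega
    · rw [mean_portColor_append hl h.length.1 h.length.2 hb, ← hl,
        portColor_append_shift h.length.1 h.length.2 (.inl hb)]
      exact (Piece.colors_iff ht h.length.1 h.length.2).1 h b hb
  · intro h
    obtain ⟨a', r, rfl, ha', hr⟩ := exists_append_of_length_eq
      (m := x.left.length + x.piece.src.length) (n := x.right.length) (a := a)
      (by simp [ha, Slice.src, add_assoc])
    obtain ⟨l, p, rfl, hl, hp⟩ := exists_append_of_length_eq ha'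
    obtain ⟨b', r', rfl, hb', hr'⟩ := exists_append_of_length_eq
      (m := x.left.length + x.piece.tgt.length) (n := x.right.length) (a := b)
      (by simp [hb, Slice.tgt, add_assoc])
    obtain ⟨l', q, rfl, hl', hq⟩ := exists_append_of_length_eq hb'
    -- Along a vertical strand harmonicity says that both ends have the same colour, so the outer
    -- words at the bottom and at the top coincide.
    obtain rfl : l = l' := by
      refine List.ext_getElem (by omega) fun i hi hi' => ?_
      have h₁ : x.left[i]? = some x.left[i] := by simp
      have := h _ (isEntry_entry (getElem?_src_left h₁) (getElem?_tgt_left h₁))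
      rw [passes_left h₁, mean_plain, entry_eq_leave_iff] at this
      simpa [portColor, List.getElem?_append_left, hi, hi'] using this
    obtain rfl : r = r' := by
      refine List.ext_getElem (by omega) fun i hi hi' => ?_
      have h₁ : x.right[i]? = some x.right[i] := by simp
      have := h (entry x.right[i] (x.rightBot i) (x.rightTop i))
        (isEntry_entry (by rw [getElem?_src_right, h₁]) (by rw [getElem?_tgt_right, h₁]))
      rw [passes_right h₁, mean_plain, entry_eq_leave_iff] at this
      simp only [portColor, rightBot, rightTop] at this
      rw [List.getD_append_right _ _ _ _ (by simp; omega),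
        List.getD_append_right _ _ _ _ (by simp; omega)] at this
      simpa [hl, hp, hq, hi, hi'] using this
    refine ⟨l, p, q, r, hl, hr, rfl, rfl, (Piece.colors_iff ht hp hq).2 fun b hb => ?_⟩
    have := h _ (isEntry_shift hb)
    rwa [mean_portColor_append hl hp hq hb, ← hl,
      portColor_append_shift hp hq (.inl hb)] at this

end SlicePorts

/-! ### Colourings of a diagram as harmonic functions -/

section Diagrams

variable {s s' : List Bool} {D : List Slice}

/-- The word of signs at height `h`. -/
def wordAt (s : List Bool) (D : List Slice) (h : ℕ) : List Bool := (s :: D.map Slice.tgt).getD h []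

theorem isPoint_iff {p : Point} : IsPoint s D p ↔ p.2 < (wordAt s D p.1).length := by
  simp only [IsPoint, wordAt, List.getD]
  cases (s :: D.map Slice.tgt)[p.1]? <;> simp

theorem wordAt_succ {h : ℕ} {x : Slice} (hx : D[h]? = some x) : wordAt s D (h + 1) = x.tgt := by
  simp [wordAt, hx]

theorem wordAt_eq_src (hD : IsTangleDiagram s D s') {h : ℕ} {x : Slice} (hx : D[h]? = some x) :
    wordAt s D h = x.src := by
  induction D generalizing s h with
  | nil => simp at hx
  | cons y D ih =>
    obtain ⟨rfl, hD⟩ := hD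
    cases h with
    | zero => cases hx; rfl
    | succ h => rw [← ih hD (by simpa using hx)]; rfl

theorem wordAt_length (hD : IsTangleDiagram s D s') : wordAt s D D.length = s' := by
  induction D generalizing s with
  | nil => cases hD; rfl
  | cons y D ih => rw [← ih hD.2]; rfl

theorem wordAt_of_length_lt {h : ℕ} (hh : D.length < h) : wordAt s D h = [] := by
  rw [wordAt, List.getD_eq_default]
  simpa using hh

/-- The continuations of an admissible path at a point. -/
def outs (D : List Slice) (p : Point) : Set (Passage × Point) := {y | Step D p y.2 y.1}

theorem Port.pointAt_injective (h : ℕ) : Function.Injective (Port.pointAt h) := by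
  rintro (p | p) (q | q) <;> simp [Port.pointAt]

theorem isPoint_pointAt (hD : IsTangleDiagram s D s') {h : ℕ} {x : Slice} (hx : D[h]? = some x)
    {a : Port} (ha : IsEntry x.src x.tgt a ∨ IsExit x.src x.tgt a) :
    IsPoint s D (a.pointAt h) := by
  rw [isPoint_iff]
  rcases a with p | p
  · simp only [Port.pointAt, wordAt_eq_src hD hx]
    rcases ha with ha | ha <;> exact (List.getElem?_eq_some_iff.1 ha).1
  · simp only [Port.pointAt, wordAt_succ hx]
    rcases ha with ha | ha <;> exact (List.getElem?_eq_some_iff.1 ha).1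

theorem Step.isPoint (hD : IsTangleDiagram s D s') {p q : Point} {k : Passage}
    (h : Step D p q k) : IsPoint s D p ∧ IsPoint s D q := by
  obtain ⟨h, x, a, b, k, hx, hp⟩ := h
  exact ⟨isPoint_pointAt hD hx (.inl hp.isEntry), isPoint_pointAt hD hx (.inr hp.isExit)⟩

/-- A point is the entry of at most one slice. -/
theorem entry_unique (hD : IsTangleDiagram s D s') {h h' : ℕ} {x x' : Slice}
    (hx : D[h]? = some x) (hx' : D[h']? = some x') {a a' : Port} (ha : IsEntry x.src x.tgt a)
    (ha' : IsEntry x'.src x'.tgt a') (haa' : a.pointAt h = a'.pointAt h') : h = h' := by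
  rcases a with p | p <;> rcases a' with q | q <;>
    simp only [Port.pointAt, Prod.mk.injEq, IsEntry] at haa' ha ha'
  · exact haa'.1
  -- A point entering both the slice above and the slice below would lie on a strand that is upward
  -- and downward.
  · obtain ⟨rfl, rfl⟩ := haa'
    rw [← wordAt_eq_src hD hx, wordAt_succ hx', ha'] at ha
    cases ha
  · obtain ⟨rfl, rfl⟩ := haa'
    rw [← wordAt_eq_src hD hx', wordAt_succ hx, ha] at ha'
    cases ha'
  · omega

theorem outs_pointAt (hD : IsTangleDiagram s D s') {h : ℕ} {x : Slice} (hx : D[h]? = some x)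
    {a : Port} (ha : IsEntry x.src x.tgt a) :
    outs D (a.pointAt h) = Prod.map id (Port.pointAt h) '' x.passes a := by
  ext ⟨k, q⟩
  constructor
  · intro h'
    simp only [outs, Set.mem_ofPred_eq] at h'
    generalize hp : a.pointAt h = p at h'
    obtain ⟨h', x', a', b, k, hx', hp'⟩ := h'
    obtain rfl := entry_unique hD hx hx' ha hp'.isEntry hp
    obtain rfl := Port.pointAt_injective _ hp
    obtain rfl : x = x' := Option.some.inj (hx.symm.trans hx')
    exact ⟨(k, b), hp', rfl⟩
  · rintro ⟨⟨k, b⟩, h', ⟨⟩⟩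
    exact .mk h x a b k hx h'

theorem isBranching_outs (hD : IsTangleDiagram s D s') {h : ℕ} {x : Slice} (hx : D[h]? = some x)
    {a : Port} (ha : IsEntry x.src x.tgt a) : IsBranching (outs D (a.pointAt h)) := by
  rw [outs_pointAt hD hx ha]
  exact (Slice.isBranching_passes ha).image _

/-- The function `u` on the points of a diagram is harmonic with respect to the random walk away
from the end points of the diagram. -/
def IsHarmonic (t : ℝ) (D : List Slice) (u : Point → ℝ) : Prop :=
  ∀ p, (outs D p).Nonempty → u p = mean t u (outs D p)

theorem isHarmonic_iff (hD : IsTangleDiagram s D s') {t : ℝ} {u : Point → ℝ} :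
    IsHarmonic t D u ↔ ∀ (h : ℕ) (x : Slice) (a : Port), D[h]? = some x → IsEntry x.src x.tgt a →
      u (a.pointAt h) = mean t (u ∘ Port.pointAt h) (x.passes a) := by
  constructor
  · intro H h x a hx ha
    rw [← (Slice.isBranching_passes ha).mean_image, ← outs_pointAt hD hx ha]
    refine H _ ?_
    exact (isBranching_outs hD hx ha).nonempty
  · rintro H p ⟨⟨k, q⟩, h, x, a, b, k, hx, ha⟩
    rw [H h x a hx ha.isEntry, outs_pointAt hD hx ha.isEntry,
      (Slice.isBranching_passes ha.isEntry).mean_image]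

/-- A family of words indexed by the height is the form in which a colouring can be compared with a
function on points. -/
theorem diagramColors_iff_chain {K : Type*} [Field K] {t : K} {a c : List K} :
    DiagramColors t D a c ↔ ∃ A : ℕ → List K, A 0 = a ∧ A D.length = c ∧
      ∀ (h : ℕ) (x : Slice), D[h]? = some x → x.Colors t (A h) (A (h + 1)) := by
  induction D generalizing a with
  | nil =>
    constructor
    · rintro rfl; exact ⟨fun _ => a, by simp⟩
    · rintro ⟨A, rfl, rfl, -⟩; rfl
  | cons x D ih =>
    simp only [DiagramColors, ih]
    constructor
    · rintro ⟨b, hb, A, rfl, rfl, h⟩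
      refine ⟨fun | 0 => a | h + 1 => A h, rfl, rfl, ?_⟩
      rintro (_ | h') y hy
      · cases hy; exact hb
      · exact h h' y (by simpa using hy)
    · rintro ⟨A, rfl, rfl, h⟩
      exact ⟨A 1, h 0 x rfl, fun h => A (h + 1), rfl, rfl, fun h' y hy => h (h' + 1) y (by simpa)⟩

/-- The colourings of a diagram are the harmonic functions on its points. -/
theorem diagramColors_iff_isHarmonic (hD : IsTangleDiagram s D s') {t : ℝ} (ht : t ≠ 0)
    (f : Fin s.length → ℝ) (g : Fin s'.length → ℝ) :
    DiagramColors t D (List.ofFn f) (List.ofFn g) ↔ ∃ u, IsHarmonic t D u ∧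
      (∀ i : Fin s.length, u (0, i) = f i) ∧ ∀ j : Fin s'.length, u (D.length, j) = g j := by
  rw [diagramColors_iff_chain]
  constructor
  · rintro ⟨A, h₀, h₁, h⟩
    -- The value `0` off the diagram is harmless, since harmonicity is required only at points with
    -- a continuation.
    refine ⟨fun p => (A p.1).getD p.2 0, ?_, ?_, ?_⟩
    · rw [isHarmonic_iff hD]
      intro i x a hx ha
      have hc := h i x hx
      have := (Slice.colors_iff ht hc.length.1 hc.length.2).1 hc a ha
      have hu : (fun p : Point => (A p.1).getD p.2 0) ∘ Port.pointAt i =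
          portColor (A i) (A (i + 1)) := by
        ext (_ | _) <;> rfl
      rw [hu, ← this, ← hu]
      rfl
    · intro i; simp [h₀]
    · intro i; simp [h₁]
  · rintro ⟨u, hu, h₀, h₁⟩
    refine ⟨fun h => List.ofFn fun i : Fin (wordAt s D h).length => u (h, i), ?_, ?_, ?_⟩
    · simp [wordAt]
      exact funext fun i => h₀ i
    · simp only
      rw [List.ofFn_congr (congrArg List.length (wordAt_length hD))]
      simp
      exact funext fun i => h₁ i
    · intro h x hx
      rw [Slice.colors_iff ht (by simp [wordAt_eq_src hD hx]) (by simp [wordAt_succ hx])]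
      intro a ha
      have key (b : Port) (hb : IsEntry x.src x.tgt b ∨ IsExit x.src x.tgt b) :
          portColor (List.ofFn fun i : Fin (wordAt s D h).length => u (h, i))
            (List.ofFn fun i : Fin (wordAt s D (h + 1)).length => u (h + 1, i)) b =
            u (b.pointAt h) := by
        have := isPoint_iff.1 (isPoint_pointAt hD hx hb)
        rcases b with p | p <;> simp only [Port.pointAt] at this <;>
          simp [portColor, Port.pointAt, this]
      rw [key a (.inl ha), (isHarmonic_iff hD).1 hu h x a hx ha]
      exact mean_congr fun y hy => (key y.2 (.inr (Slice.Pass.isExit hy))).symm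

end Diagrams

/-! ### Convergence of path sums and the maximum principle -/

section PathSums

variable {D : List Slice} {t : ℝ}

/-- An admissible path is trivial, or it starts with one of the possible continuations. -/
def pathEquiv (D : List Slice) (p q : Point) :
    Path D p q ≃ PLift (p = q) ⊕ Σ y : outs D p, Path D y.1.2 q where
  toFun
    | .nil _ => .inl ⟨rfl⟩
    | .cons (q := r) k h P => .inr ⟨⟨(k, r), h⟩, P⟩
  invFun
    | .inl ⟨h⟩ => h ▸ .nil p
    | .inr ⟨y, P⟩ => .cons y.1.1 y.2 P
  left_inv P := by cases P <;> rfl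
  right_inv x := by rcases x with ⟨⟨rfl⟩⟩ | ⟨y, P⟩ <;> rfl

/-- The number of steps of an admissible path. -/
def Path.length : {p q : Point} → Path D p q → ℕ
  | _, _, .nil _ => 0
  | _, _, .cons _ _ P => P.length + 1

/-- The function `h` exceeds by one at least its expected value after one step of the random walk
with the absolute values of the weights. -/
structure IsSuperharmonic (t : ℝ) (D : List Slice) (h : Point → ℝ) : Prop where
  finite (p : Point) : (outs D p).Finite
  pos (p : Point) : 0 < h p
  le (p : Point) : 1 + ∑' y : outs D p, |y.1.1.weight t| * h y.1.2 ≤ h p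

variable {h : Point → ℝ}

/-- Splitting off the first step, the trivial path contributes at most `1` and the others, by
induction, at most the mean of `h` for the absolute weights; superharmonicity bounds the total. In
`ℝ≥0∞` the sums may be rearranged before summability is known. -/
theorem IsSuperharmonic.tsum_length_lt_le (hh : IsSuperharmonic t D h) (q : Point) (n : ℕ)
    (p : Point) :
    ∑' P : Path D p q, (if P.length < n then ENNReal.ofReal |P.weight t| else 0) ≤
      ENNReal.ofReal (h p) := by
  induction n generalizing p with
  | zero => simp
  | succ n ih =>
    have := (hh.finite p).fintype
    rw [← (pathEquiv D p q).symm.tsum_eq,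
      Summable.tsum_sum (ENNReal.summable) (ENNReal.summable), ENNReal.tsum_sigma']
    refine le_trans ?_ (ENNReal.ofReal_le_ofReal (hh.le p))
    rw [ENNReal.ofReal_add zero_le_one (tsum_nonneg fun y => by have := hh.pos y.1.2; positivity),
      tsum_fintype fun y : outs D p => |y.1.1.weight t| * h y.1.2,
      ENNReal.ofReal_sum_of_nonneg fun y _ => by have := hh.pos y.1.2; positivity]
    refine add_le_add ?_ ((tsum_fintype _).le.trans (Finset.sum_le_sum fun y _ => ?_))
    · by_cases hpq : p = q
      · subst hpq
        rw [tsum_eq_single ⟨rfl⟩ fun x hx => (hx rfl).elim]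
        simp [pathEquiv, Path.length, Path.weight]
      · have : IsEmpty (PLift (p = q)) := ⟨fun x => hpq x.1⟩
        simp
    · rw [ENNReal.ofReal_mul (abs_nonneg _)]
      refine le_trans (le_of_eq ?_) (mul_le_mul_right (ih y.1.2) _)
      rw [← ENNReal.tsum_mul_left]
      refine tsum_congr fun P => ?_
      simp only [pathEquiv, Equiv.coe_fn_symm_mk, Path.length, Path.weight, abs_mul,
        add_lt_add_iff_right, mul_ite, mul_zero, ENNReal.ofReal_mul (abs_nonneg _)]

theorem IsSuperharmonic.summable (hh : IsSuperharmonic t D h) (p q : Point) :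
    Summable fun P : Path D p q => P.weight t := by
  refine Summable.of_abs (summable_of_sum_le (c := h p) (fun P => abs_nonneg _) fun S => ?_)
  rw [← ENNReal.ofReal_le_ofReal_iff (hh.pos p).le,
    ENNReal.ofReal_sum_of_nonneg fun P _ => abs_nonneg _]
  refine le_trans (le_trans (le_of_eq ?_) (ENNReal.sum_le_tsum S))
    -- A finite set of paths has bounded length, so the bound for truncated sums applies to it.
    (hh.tsum_length_lt_le q (S.sup Path.length + 1) p)
  refine Finset.sum_congr rfl fun P hP => ?_
  rw [if_pos (Nat.lt_succ_of_le (Finset.le_sup (f := Path.length) hP))]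

/-- The sum of the weights of all admissible paths from `p` to `q`. -/
noncomputable def pathSum (t : ℝ) (D : List Slice) (q p : Point) : ℝ :=
  ∑' P : Path D p q, P.weight t

open Classical in
-- First-step decomposition; the indicator is the contribution of the trivial path.
theorem IsSuperharmonic.pathSum_eq (hh : IsSuperharmonic t D h) (p q : Point) :
    pathSum t D q p = (if p = q then 1 else 0) + mean t (pathSum t D q) (outs D p) := by
  have := (hh.finite p).fintype
  have hs := (pathEquiv D p q).symm.summable_iff.2 (hh.summable p q)
  have hs₁ := hs.comp_injective Sum.inl_injective
  have hs₂ := hs.comp_injective Sum.inr_injective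
  rw [pathSum, ← (pathEquiv D p q).symm.tsum_eq]
  refine (Summable.tsum_sum hs₁ hs₂).trans ?_
  congr 1
  · by_cases hpq : p = q
    · subst hpq
      rw [tsum_eq_single ⟨rfl⟩ fun x hx => (hx rfl).elim]
      simp [pathEquiv, Path.weight]
    · have : IsEmpty (PLift (p = q)) := ⟨fun x => hpq x.1⟩
      simp [hpq]
  · refine (Summable.tsum_sigma hs₂).trans (tsum_congr fun y => ?_)
    rw [pathSum, ← tsum_mul_left]
    rfl

/-- Maximum principle: if `|u| / h` attains its maximum `M` over `V` at `m`, then `M * h m = |u m| ≤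
M * (h m - 1)` because of the gap of `1` in superharmonicity, whence `M = 0`. -/
theorem IsSuperharmonic.eq_zero (hh : IsSuperharmonic t D h) {V : Set Point} (hV : V.Finite)
    (hVD : ∀ p ∈ V, ∀ y ∈ outs D p, y.2 ∈ V) {u : Point → ℝ}
    (hu : ∀ p ∈ V, u p = mean t u (outs D p)) {p : Point} (hp : p ∈ V) : u p = 0 := by
  obtain ⟨m, hm, hmax⟩ := hV.exists_maximalFor (fun p => |u p| / h p) V ⟨p, hp⟩
  have hmax' (r : Point) (hr : r ∈ V) : |u r| / h r ≤ |u m| / h m :=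
    (le_total _ _).elim id fun H => hmax hr H
  set M := |u m| / h m with hM
  have hM₀ : 0 ≤ M := div_nonneg (abs_nonneg _) (hh.pos m).le
  have hle (r : Point) (hr : r ∈ V) : |u r| ≤ M * h r := (div_le_iff₀ (hh.pos r)).1 (hmax' r hr)
  have := (hh.finite m).fintype
  have h₁ : |u m| ≤ M * ∑' y : outs D m, |y.1.1.weight t| * h y.1.2 := by
    rw [hu m hm, mean, tsum_fintype, tsum_fintype, Finset.mul_sum]
    refine (Finset.abs_sum_le_sum_abs _ _).trans (Finset.sum_le_sum fun y _ => ?_)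
    rw [abs_mul, mul_left_comm]
    exact mul_le_mul_of_nonneg_left (hle _ (hVD m hm y y.2)) (abs_nonneg _)
  have h₂ : |u m| = M * h m := by rw [hM, div_mul_cancel₀ _ (hh.pos m).ne']
  have h₃ := hh.le m
  have h₄ : M = 0 := by nlinarith
  have := hle p hp
  rw [h₄, zero_mul] at this
  exact abs_nonpos_iff.1 this

end PathSums

/-! ### A superharmonic function for `t` near `1` -/

section Rank

variable {s s' : List Bool} {D : List Slice}

theorem outs_eq_empty_or_isBranching (hD : IsTangleDiagram s D s') (p : Point) :
    outs D p = ∅ ∨ IsBranching (outs D p) := by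
  rcases (outs D p).eq_empty_or_nonempty with h | ⟨⟨k, q⟩, h, x, a, b, k, hx, ha⟩
  · exact .inl h
  · exact .inr (isBranching_outs hD hx ha.isEntry)

theorem finite_outs (hD : IsTangleDiagram s D s') (p : Point) : (outs D p).Finite := by
  rcases outs_eq_empty_or_isBranching hD p with h | h
  · simp [h]
  · exact h.finite

theorem finite_isPoint (s : List Bool) (D : List Slice) : {p | IsPoint s D p}.Finite := by
  refine ((Finset.range (D.length + 1)).biUnion fun h =>
    (Finset.range (wordAt s D h).length).image (Prod.mk h)).finite_toSet.subset ?_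
  rintro ⟨h, i⟩ hp
  have hp := isPoint_iff.1 hp
  have : h < D.length + 1 := by
    by_contra hh
    rw [wordAt_of_length_lt (by simp at hh ⊢; omega)] at hp
    simp at hp
  simp only [Finset.coe_biUnion, Set.mem_iUnion]
  exact ⟨h, by simpa using this, by simpa using hp⟩

theorem outs_length_eq_empty {n : ℕ} (hD : IsTangleDiagram s D (plusWord n)) (j : ℕ) :
    outs D (D.length, j) = ∅ := by
  refine Set.eq_empty_of_forall_notMem ?_
  rintro ⟨k, q⟩ h
  simp only [outs, Set.mem_ofPred_eq] at h
  generalize hp : (D.length, j) = p at h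
  obtain ⟨h, x, a, b, k, hx, ha⟩ := h
  have ha := ha.isEntry
  have hlt := (List.getElem?_eq_some_iff.1 hx).1
  rcases a with i | i <;> simp only [Port.pointAt, Prod.mk.injEq] at hp
  · omega
  · obtain ⟨hp, rfl⟩ := hp
    simp only [IsEntry, ← wordAt_succ (s := s) hx, ← hp, wordAt_length hD] at ha
    simp [plusWord, List.getElem?_replicate] at ha

/-- An upward point enters the slice above it, which is missing only at the top; a downward point
enters the slice below it, which is never missing because the bottom word is upward. -/
theorem IsPoint.outs_eq_empty {n : ℕ} {p : Point} (hp : IsPoint (plusWord n) D p)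
    (hD : IsTangleDiagram (plusWord n) D (plusWord n)) (hout : outs D p = ∅) :
    ∃ j : Fin n, p = (D.length, (j : ℕ)) := by
  rw [isPoint_iff] at hp
  obtain ⟨i, j⟩ := p
  simp only at hp
  have hi : i ≤ D.length := by
    by_contra hi
    rw [wordAt_of_length_lt (by omega)] at hp
    simp at hp
  rcases hi.lt_or_eq with hi | rfl
  · exfalso
    have hj : (wordAt (plusWord n) D i)[j]? = some (wordAt (plusWord n) D i)[j] := by simp
    generalize (wordAt (plusWord n) D i)[j] = ε at hj
    have key (h : ℕ) (x : Slice) (a : Port) (hx : D[h]? = some x) (ha : IsEntry x.src x.tgt a)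
        (hp : (i, j) = a.pointAt h) : False :=
      (isBranching_outs hD hx ha).nonempty.ne_empty (hp ▸ hout)
    cases ε with
    | true =>
      have hx : D[i]? = some D[i] := by simp
      rw [wordAt_eq_src hD hx] at hj
      exact key i _ (.bot j) hx hj rfl
    | false =>
      cases i with
      | zero => simp [wordAt, plusWord, List.getElem?_replicate] at hj
      | succ i =>
        have hx : D[i]? = some D[i] := by simp
        rw [wordAt_succ hx] at hj
        exact key i _ (.top j) hx hj rfl
  · rw [wordAt_length hD] at hp
    exact ⟨⟨j, by simpa [plusWord] using hp⟩, rfl⟩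

/-- From `p` one gets to an end point of the diagram by `m` steps along a component. -/
def ReachesEnd (D : List Slice) : ℕ → Point → Prop
  | 0, p => outs D p = ∅
  | m + 1, p => ∃ q, StraightStep D p q ∧ ReachesEnd D m q

/-- Of two continuations only one is straight. Hence the least number of straight steps to an end
drops along every straight step. -/
theorem StraightStep.unique (hD : IsTangleDiagram s D s') {p q r : Point}
    (hq : StraightStep D p q) (hr : StraightStep D p r) : q = r := by
  obtain ⟨k, hq, hk⟩ := hq
  obtain ⟨l, hr, hl⟩ := hr
  replace hq : (k, q) ∈ outs D p := hq
  replace hr : (l, r) ∈ outs D p := hr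
  rcases outs_eq_empty_or_isBranching hD p with h | h
  · simp [h] at hq
  · generalize outs D p = S at h hq hr
    cases h <;> simp only [Set.mem_singleton_iff, Set.mem_insert_iff, Prod.mk.injEq] at hq hr
    · rw [hq.2, hr.2]
    · rw [hq.2, hr.2]
    · rcases hq with hq | hq <;> rcases hr with hr | hr
      · rw [hq.2, hr.2]
      · simp [hr.1, Passage.IsStraight] at hl
      · simp [hq.1, Passage.IsStraight] at hk
      · rw [hq.2, hr.2]

/-- This is where the absence of closed components enters: on a closed component the straight walk
would never stop. -/
theorem StringLinkDiagram.exists_reachesEnd {n : ℕ} (D : StringLinkDiagram n) (p : Point) :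
    ∃ m, ReachesEnd D.slices m p := by
  by_cases hp : IsPoint (plusWord n) D.slices p
  · obtain ⟨-, -, j, -, -, h⟩ := D.isStringLink p hp
    induction h using Relation.ReflTransGen.head_induction_on with
    | refl => exact ⟨0, outs_length_eq_empty D.isTangleDiagram j⟩
    | head h _ ih =>
      obtain ⟨m, hm⟩ := ih (by obtain ⟨k, h, -⟩ := h; exact (h.isPoint D.isTangleDiagram).2)
      exact ⟨m + 1, _, h, hm⟩
  · refine ⟨0, Set.eq_empty_of_forall_notMem fun y hy => hp ?_⟩
    exact (Step.isPoint D.isTangleDiagram hy).1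

/-- There is a bounded function on the points which decreases along the components. -/
theorem StringLinkDiagram.exists_rank {n : ℕ} (D : StringLinkDiagram n) :
    ∃ (ρ : Point → ℕ) (N : ℕ), (∀ p, ρ p ≤ N) ∧
      ∀ p q, StraightStep D.slices p q → ρ q < ρ p := by
  classical
  obtain ⟨N, hN⟩ := ((finite_isPoint (plusWord n) D.slices).image fun p =>
    Nat.find (D.exists_reachesEnd p)).bddAbove
  refine ⟨fun p => Nat.find (D.exists_reachesEnd p), N, fun p => ?_, fun p q h => ?_⟩
  · by_cases hp : IsPoint (plusWord n) D.slices p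
    · exact hN ⟨p, hp, rfl⟩
    · refine (Nat.find_min' _ ?_).trans (Nat.zero_le N)
      refine Set.eq_empty_of_forall_notMem fun y hy => hp ?_
      exact (Step.isPoint D.isTangleDiagram hy).1
  · have hm := Nat.find_spec (D.exists_reachesEnd p)
    beta_reduce
    generalize Nat.find (D.exists_reachesEnd p) = m at hm
    cases m with
    | zero =>
      obtain ⟨k, hk, -⟩ := h
      exact absurd hm (Set.Nonempty.ne_empty ⟨(k, q), hk⟩)
    | succ m =>
      obtain ⟨r, hr, hm⟩ := hm
      obtain rfl := h.unique D.isTangleDiagram hr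
      exact Nat.lt_succ_of_le (Nat.find_min' _ hm)

/-- If the weights of the passages from one strand to another are small enough, then the walk has
a superharmonic function. -/
theorem isSuperharmonic_of_rank {D : List Slice} (hD : IsTangleDiagram s D s') {ρ : Point → ℕ}
    {N : ℕ} (hN : ∀ p, ρ p ≤ N) (hρ : ∀ p q, StraightStep D p q → ρ q < ρ p) {t : ℝ}
    (h₁ : |1 - t| ≤ (4 * 4 ^ N)⁻¹) (h₂ : |1 - t⁻¹| ≤ (4 * 4 ^ N)⁻¹) :
    IsSuperharmonic t D fun p => 4 * 4 ^ ρ p where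
  finite := finite_outs hD
  pos p := by positivity
  le p := by
    have hle : (1 : ℝ) ≤ 4 ^ ρ p := one_le_pow₀ (by norm_num)
    have hN₁ : (1 : ℝ) ≤ 4 ^ N := one_le_pow₀ (by norm_num)
    have hε : (4 * 4 ^ N : ℝ)⁻¹ ≤ 1 := inv_le_one_of_one_le₀ (by linarith)
    have hstraight (q : Point) (h : StraightStep D p q) : (4 : ℝ) * 4 ^ ρ q ≤ 4 ^ ρ p := by
      rw [← pow_succ']
      exact pow_le_pow_right₀ (by norm_num) (hρ p q h)
    -- Going straight contributes at most `2 * 4 ^ ρ p`, since `|w| ≤ 2` and the rank decreases. The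
    -- target of a drop may have any rank up to `N`, but its small weight makes that term at most
    -- `1`. Finally `1 + 2 * 4 ^ ρ p + 1 ≤ 4 * 4 ^ ρ p`.
    have hdrop (w : ℝ) (hw : |1 - w| ≤ (4 * 4 ^ N)⁻¹) (q q' : Point)
        (h : StraightStep D p q) :
        1 + (|w| * (4 * 4 ^ ρ q) + |1 - w| * (4 * 4 ^ ρ q')) ≤ (4 : ℝ) * 4 ^ ρ p := by
      have h₃ : |w| ≤ 2 := by
        have := abs_le.1 (hw.trans hε)
        exact abs_le.2 ⟨by linarith, by linarith⟩
      have h₄ := hstraight q h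
      have h₅ : (4 : ℝ) ^ ρ q' ≤ 4 ^ N := pow_le_pow_right₀ (by norm_num) (hN q')
      have h₆ : |1 - w| * (4 * 4 ^ ρ q') ≤ (4 * 4 ^ N)⁻¹ * (4 * 4 ^ N) :=
        mul_le_mul hw (by linarith) (by positivity) (by positivity)
      rw [inv_mul_cancel₀ (by positivity)] at h₆
      have h₇ : |w| * (4 * 4 ^ ρ q) ≤ 2 * 4 ^ ρ p :=
        mul_le_mul h₃ h₄ (by positivity) (by norm_num)
      linarith
    have hout (k : Passage) (q : Point) (h : (k, q) ∈ outs D p) (hk : k.IsStraight) :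
      StraightStep D p q := ⟨k, h, hk⟩
    rcases outs_eq_empty_or_isBranching hD p with h | h
    · rw [h, tsum_empty]; linarith
    · generalize outs D p = S at h hout
      cases h with
      | plain q =>
        have := hstraight q (hout .plain q (by simp) (by simp [Passage.IsStraight]))
        rw [tsum_singleton (Passage.plain, q) fun y => |y.1.weight t| * (4 * 4 ^ ρ y.2)]
        simp only [Passage.weight, abs_one, one_mul]
        linarith
      | under q =>
        have := hstraight q (hout .under q (by simp) (by simp [Passage.IsStraight]))
        rw [tsum_singleton (Passage.under, q) fun y => |y.1.weight t| * (4 * 4 ^ ρ y.2)]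
        simp only [Passage.weight, abs_one, one_mul]
        linarith
      | split b q q' =>
        have := hout (.over b) q (by simp) (by simp [Passage.IsStraight])
        rw [tsum_pair (a := (Passage.over b, q)) (b := (Passage.drop b, q')) (by simp) fun y => |y.1.weight t| * (4 * 4 ^ ρ y.2)]
        cases b
        · exact hdrop _ h₂ q q' this
        · exact hdrop _ h₁ q q' this

theorem StringLinkDiagram.eventually_isSuperharmonic {n : ℕ} (D : StringLinkDiagram n) :
    ∀ᶠ t : ℝ in 𝓝 1, t ≠ 0 ∧ ∃ h, IsSuperharmonic t D.slices h := by
  obtain ⟨ρ, N, hN, hρ⟩ := D.exists_rank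
  have hε : (0 : ℝ) < (4 * 4 ^ N)⁻¹ := by positivity
  have h₁ : Filter.Tendsto (fun t : ℝ => |1 - t|) (𝓝 1) (𝓝 0) := by
    have : ContinuousAt (fun t : ℝ => |1 - t|) 1 := by fun_prop
    simpa [ContinuousAt] using this
  have h₂ : Filter.Tendsto (fun t : ℝ => |1 - t⁻¹|) (𝓝 1) (𝓝 0) := by
    have : ContinuousAt (fun t : ℝ => |1 - t⁻¹|) 1 := by fun_prop (disch := norm_num)
    simpa [ContinuousAt] using this
  filter_upwards [h₁.eventually_lt_const hε, h₂.eventually_lt_const hε,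
    eventually_ne_nhds one_ne_zero] with t h₁ h₂ h₀
  exact ⟨h₀, _, isSuperharmonic_of_rank D.isTangleDiagram hN hρ h₁.le h₂.le⟩

end Rank

/-! ### Path sums as the matrix of the colouring relation -/

section Transfer

theorem diagramColors_ofFn_iff {s s' : List Bool} {D : List Slice} (hD : IsTangleDiagram s D s')
    {t : ℝ} (ht : t ≠ 0) {m n : ℕ} (hm : s.length = m) (hn : s'.length = n)
    (f : Fin m → ℝ) (g : Fin n → ℝ) :
    DiagramColors t D (List.ofFn f) (List.ofFn g) ↔ ∃ u, IsHarmonic t D u ∧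
      (∀ i : Fin m, u (0, i) = f i) ∧ ∀ j : Fin n, u (D.length, j) = g j := by
  subst hm hn
  exact diagramColors_iff_isHarmonic hD ht f g

theorem mean_empty {α : Type*} (t : ℝ) (u : α → ℝ) : mean t u ∅ = 0 := tsum_empty

theorem mean_sub {α : Type*} (t : ℝ) (u v : α → ℝ) {S : Set (Passage × α)} (hS : S.Finite) :
    mean t (fun p => u p - v p) S = mean t u S - mean t v S := by
  have := hS.fintype
  simp [mean, tsum_fintype, mul_sub]

theorem mean_sum_mul {α ι : Type*} [Fintype ι] (t : ℝ) (c : ι → ℝ) (u : ι → α → ℝ)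
    {S : Set (Passage × α)} (hS : S.Finite) :
    mean t (fun p => ∑ i, c i * u i p) S = ∑ i, c i * mean t (u i) S := by
  have := hS.fintype
  simp only [mean, tsum_fintype, Finset.mul_sum]
  rw [Finset.sum_comm]
  simp only [mul_left_comm]

variable {n : ℕ} (D : StringLinkDiagram n) {t : ℝ} {h : Point → ℝ}

theorem StringLinkDiagram.pathSum_end (hh : IsSuperharmonic t D.slices h) (j k : ℕ) :
    pathSum t D.slices (D.slices.length, k) (D.slices.length, j) = if j = k then 1 else 0 := by
  classical
  rw [hh.pathSum_eq, outs_length_eq_empty D.isTangleDiagram, mean_empty]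
  simp

theorem StringLinkDiagram.isHarmonic_pathSum (hh : IsSuperharmonic t D.slices h) (k : ℕ) :
    IsHarmonic t D.slices (pathSum t D.slices (D.slices.length, k)) := by
  classical
  intro p hp
  rw [hh.pathSum_eq, if_neg, zero_add]
  rintro rfl
  exact hp.ne_empty (outs_length_eq_empty D.isTangleDiagram k)

/-- The path sums express the colours at the bottom in terms of those at the top. -/
theorem StringLinkDiagram.diagramColors_iff (hh : IsSuperharmonic t D.slices h) (ht : t ≠ 0)
    (f g : Fin n → ℝ) : DiagramColors t D.slices (List.ofFn f) (List.ofFn g) ↔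
      ∀ i, f i = ∑ j : Fin n, g j * pathSum t D.slices (D.slices.length, j) (0, i) := by
  have hD := D.isTangleDiagram
  have hfin := finite_outs hD
  rw [diagramColors_ofFn_iff hD ht (by simp [plusWord]) (by simp [plusWord])]
  set u₀ : Point → ℝ := fun p => ∑ j : Fin n, g j * pathSum t D.slices (D.slices.length, j) p
    with hu₀
  have hu₀h : IsHarmonic t D.slices u₀ := by
    intro p hp
    rw [hu₀, mean_sum_mul t _ _ (hfin p)]
    simp only [← D.isHarmonic_pathSum hh _ p hp]
  have hu₀e (j : Fin n) : u₀ (D.slices.length, j) = g j := by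
    simp [hu₀, D.pathSum_end hh, Fin.val_inj]
  constructor
  · rintro ⟨u, hu, hf, hg⟩ i
    -- The maximum principle is applied to the difference of two harmonic functions with the same
    -- top values. At a top point the mean is an empty sum, so the required equation says exactly
    -- that the difference vanishes there.
    have key := hh.eq_zero (finite_isPoint (plusWord n) D.slices)
      (fun p _ y hy => (Step.isPoint hD hy).2) (u := fun p => u p - u₀ p) (fun p hp => ?_)
      (p := (0, (i : ℕ))) (isPoint_iff.2 (by simp [wordAt, plusWord]))
    · rw [← hf i]; exact sub_eq_zero.1 key
    · rcases (outs D.slices p).eq_empty_or_nonempty with hp' | hp'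
      · obtain ⟨j, rfl⟩ := IsPoint.outs_eq_empty hp hD hp'
        rw [hp', mean_empty, hg, hu₀e, sub_self]
      · rw [mean_sub t _ _ (hfin p), ← hu p hp', ← hu₀h p hp']
  · intro hf
    exact ⟨u₀, hu₀h, fun i => (hf i).symm, hu₀e⟩

theorem StringLinkDiagram.sum_pathSum (hh : IsSuperharmonic t D.slices h) (ht : t ≠ 0)
    (i : Fin n) : ∑ j : Fin n, pathSum t D.slices (D.slices.length, j) (0, i) = 1 := by
  have := DiagramColors.ones (t := t) D.isTangleDiagram
  rw [show (plusWord n).length = n by simp [plusWord], ← List.ofFn_const] at this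
  simpa using ((D.diagramColors_iff hh ht _ _).1 this i).symm

/-- With the unit vector at `j` as top word, the bottom word is row `j` of the matrix; the two sides
are the flows at the bottom and at the top. -/
theorem StringLinkDiagram.sum_pow_mul_pathSum (hh : IsSuperharmonic t D.slices h) (ht : t ≠ 0)
    (j : Fin n) : ∑ i : Fin n, t ^ (i : ℕ) *
      pathSum t D.slices (D.slices.length, j) (0, i) = t ^ (j : ℕ) := by
  have := (D.diagramColors_iff hh ht
    (fun i => pathSum t D.slices (D.slices.length, j) (0, i)) (Pi.single j 1)).2
    (fun i => by simp [Pi.single_apply])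
  have := this.flow_eq ht D.isTangleDiagram
  rw [flow_plusWord, flow_plusWord] at this
  simpa [Pi.single_apply] using this

/-- The colouring of `D` whose top word is a unit vector has the same end words as a colouring of
`D'`, and in both diagrams the bottom word consists of path sums. -/
theorem StringLinkDiagram.Move.pathSum_eq {D D' : StringLinkDiagram n} (hDD' : D.Move D')
    {h' : Point → ℝ} (hh : IsSuperharmonic t D.slices h) (hh' : IsSuperharmonic t D'.slices h')
    (ht : t ≠ 0) (i j : Fin n) :
    pathSum t D.slices (D.slices.length, j) (0, i) =
      pathSum t D'.slices (D'.slices.length, j) (0, i) := by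
  have := (D.diagramColors_iff hh ht
    (fun i => pathSum t D.slices (D.slices.length, j) (0, i)) (Pi.single j 1)).2
    (fun i => by simp [Pi.single_apply])
  rw [hDD'.diagramColors_iff _ ht (by simp)] at this
  simpa [Pi.single_apply] using (D'.diagramColors_iff hh' ht _ _).1 this i

end Transfer

/-! ### Rational functions, Cramer's rule and the equilibrium -/

section Rationality

open Polynomial

theorem ratFunc_eval_div {f : ℚ →+* ℝ} {t : ℝ} (p : ℚ[X]) {q : ℚ[X]} (hq : q.eval₂ f t ≠ 0) :
    (algebraMap ℚ[X] (RatFunc ℚ) p / algebraMap ℚ[X] (RatFunc ℚ) q).eval f t =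
      p.eval₂ f t / q.eval₂ f t := by
  have hq₀ : q ≠ 0 := by rintro rfl; simp at hq
  have hq₁ : algebraMap ℚ[X] (RatFunc ℚ) q ≠ 0 := by simpa using hq₀
  rw [eq_div_iff hq]
  -- `RatFunc.eval` uses the reduced fraction, whose denominator divides `q` and so does not vanish
  -- at `t`.
  obtain ⟨r, hr⟩ := RatFunc.denom_div_dvd p q
  have := RatFunc.eval_mul (f := f) (a := t)
    (x := algebraMap ℚ[X] (RatFunc ℚ) p / algebraMap ℚ[X] (RatFunc ℚ) q)
    (y := algebraMap ℚ[X] (RatFunc ℚ) q) (fun h => hq (by rw [hr, eval₂_mul, h, zero_mul]))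
    (by simp)
  rw [div_mul_cancel₀ _ hq₁] at this
  simpa using this.symm

/-- At a transcendental number, evaluation of rational functions is a ring homomorphism, and any
property that holds near `1` holds at some transcendental number. -/
theorem exists_evalHom {P : ℝ → Prop} (h : ∀ᶠ t in 𝓝 1, P t) :
    ∃ (t : ℝ) (φ : RatFunc ℚ →+* ℝ), P t ∧ φ RatFunc.X = t ∧
      ∀ x, φ x = x.eval (algebraMap ℚ ℝ) t := by
  obtain ⟨t, ht, hP⟩ := ((Algebraic.countable ℚ ℝ).dense_compl ℝ).inter_nhds_nonempty h
  have hden (x : RatFunc ℚ) : x.denom.eval₂ (algebraMap ℚ ℝ) t ≠ 0 := fun h =>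
    ht ⟨x.denom, x.denom_ne_zero, h⟩
  exact ⟨t, { toFun := fun x => x.eval (algebraMap ℚ ℝ) t
              map_zero' := RatFunc.eval_zero _ _
              map_one' := RatFunc.eval_one _ _
              map_add' := fun x y => RatFunc.eval_add _ _ (hden x) (hden y)
              map_mul' := fun x y => RatFunc.eval_mul _ _ (hden x) (hden y) },
    hP, RatFunc.eval_X _ _, fun x => rfl⟩

/-- The weight of a passage, multiplied by the variable. -/
noncomputable def Passage.weightPoly : Passage → ℚ[X]
  | .plain => X
  | .under => X
  | .over true => X ^ 2
  | .over false => 1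
  | .drop true => X - X ^ 2
  | .drop false => X - 1

theorem Passage.eval_weightPoly {t : ℝ} (ht : t ≠ 0) (k : Passage) :
    k.weightPoly.eval₂ (algebraMap ℚ ℝ) t = t * k.weight t := by
  rcases k with _ | _ | (_ | _) | (_ | _) <;>
    simp [weightPoly, weight, mul_sub, ht, sq]

theorem mean_eq_sum {α : Type*} (t : ℝ) (u : α → ℝ) {S : Set (Passage × α)} (hS : S.Finite) :
    mean t u S = ∑ y ∈ hS.toFinset, y.1.weight t * u y.2 := by
  obtain ⟨F, rfl⟩ := hS.exists_finset_coe
  rw [Finset.finite_toSet_toFinset]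
  exact Finset.tsum_subtype' F fun y => y.1.weight t * u y.2

variable {n : ℕ} (D : StringLinkDiagram n)

/-- The points of a diagram. -/
abbrev StringLinkDiagram.Vertex : Type := {p : Point // IsPoint (plusWord n) D.slices p}

noncomputable instance : Fintype D.Vertex := (finite_isPoint (plusWord n) D.slices).fintype

open Classical in
/-- The matrix of polynomials whose value at `t` is `t` times the difference of the identity and
the transition matrix of the random walk. -/
noncomputable def StringLinkDiagram.walkMatrix : Matrix D.Vertex D.Vertex ℚ[X] := fun p r =>
  (if p = r then X else 0) - ∑ y ∈ (finite_outs D.isTangleDiagram p.1).toFinset,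
    if y.2 = r.1 then y.1.weightPoly else 0

open Classical in
theorem StringLinkDiagram.walkMatrix_mulVec {t : ℝ} (ht : t ≠ 0) (u : Point → ℝ) (p : D.Vertex) :
    (((eval₂RingHom (algebraMap ℚ ℝ) t).mapMatrix D.walkMatrix) *ᵥ fun r => u r.1) p =
      t * (u p.1 - mean t u (outs D.slices p.1)) := by
  have key (y : Passage × Point) (hy : y ∈ (finite_outs D.isTangleDiagram p.1).toFinset) :
      ∑ r : D.Vertex, (if y.2 = r.1 then t * y.1.weight t else 0) * u r.1 =
        t * (y.1.weight t * u y.2) := by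
    have hy' : Step D.slices p.1 y.2 y.1 :=
      show y ∈ outs D.slices p.1 from (Set.Finite.mem_toFinset _).1 hy
    rw [Finset.sum_eq_single (⟨y.2, (hy'.isPoint D.isTangleDiagram).2⟩ : D.Vertex)]
    · simp [mul_assoc]
    · intro r _ hr
      rw [if_neg fun h => hr (Subtype.ext h.symm), zero_mul]
    · simp
  rw [mean_eq_sum t u (finite_outs D.isTangleDiagram p.1), mul_sub, Finset.mul_sum,
    ← Finset.sum_congr rfl key, Finset.sum_comm]
  have hX : eval₂RingHom (algebraMap ℚ ℝ) t X = t := eval₂_X _ _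
  have hw (k : Passage) : eval₂RingHom (algebraMap ℚ ℝ) t k.weightPoly = t * k.weight t :=
    k.eval_weightPoly ht
  generalize eval₂RingHom (algebraMap ℚ ℝ) t = φ at hX hw
  simp only [mulVec, dotProduct, RingHom.mapMatrix_apply, map_apply, walkMatrix, map_sub, map_sum,
    apply_ite φ, map_zero, hX, hw, sub_mul, Finset.sum_sub_distrib, Finset.sum_mul]
  simp

open Classical in
-- A kernel vector, extended by zero, equals its mean at every point of the diagram, including the
-- top points; the maximum principle makes it vanish.
theorem StringLinkDiagram.det_walkMatrix_ne_zero {t : ℝ} {h : Point → ℝ}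
    (hh : IsSuperharmonic t D.slices h) (ht : t ≠ 0) :
    D.walkMatrix.det.eval₂ (algebraMap ℚ ℝ) t ≠ 0 := by
  intro h₀
  have h₁ : ((eval₂RingHom (algebraMap ℚ ℝ) t).mapMatrix D.walkMatrix).det = 0 := by
    rw [← RingHom.map_det]; exact h₀
  obtain ⟨v, hv, hv'⟩ := exists_mulVec_eq_zero_iff.2 h₁
  set u : Point → ℝ := fun p =>
    if hp : IsPoint (plusWord n) D.slices p then v ⟨p, hp⟩ else 0 with hu
  have huv : v = fun r => u r.1 := by
    ext r
    simp only [hu]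
    rw [dif_pos r.2]
  refine hv (funext fun r => ?_)
  rw [huv]
  refine hh.eq_zero (finite_isPoint (plusWord n) D.slices)
    (fun p _ y hy => (Step.isPoint D.isTangleDiagram hy).2) (fun p hp => ?_) r.2
  have := congrFun hv' ⟨p, hp⟩
  rw [huv, D.walkMatrix_mulVec ht] at this
  exact sub_eq_zero.1 ((mul_eq_zero.1 this).resolve_left ht)

open Classical in
-- By first-step decomposition the walk matrix at `t` sends the vector of path sums ending at `q` to
-- `t` times a unit vector; multiplying by the adjugate gives Cramer's rule. The factor `X` in the
-- numerator makes up for the factor that clears `t⁻¹` from the weights.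
theorem StringLinkDiagram.pathSum_eq_adjugate {t : ℝ} {h : Point → ℝ}
    (hh : IsSuperharmonic t D.slices h) (ht : t ≠ 0) (p q : D.Vertex) :
    pathSum t D.slices q.1 p.1 = (X * D.walkMatrix.adjugate p q).eval₂ (algebraMap ℚ ℝ) t /
      D.walkMatrix.det.eval₂ (algebraMap ℚ ℝ) t := by
  rw [eq_div_iff (D.det_walkMatrix_ne_zero hh ht), mul_comm]
  set φ := eval₂RingHom (algebraMap ℚ ℝ) t with hφ
  have h₁ : φ.mapMatrix D.walkMatrix *ᵥ (fun r => pathSum t D.slices q.1 r.1) =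
      Pi.single q t := by
    ext r
    rw [D.walkMatrix_mulVec ht, hh.pathSum_eq r.1 q.1]
    have : r.1 = q.1 ↔ r = q := Subtype.ext_iff.symm
    simp [Pi.single_apply, this]
  have h₂ := congrArg (fun v => ((φ.mapMatrix D.walkMatrix).adjugate *ᵥ v) p) h₁
  simp only [mulVec_mulVec, adjugate_mul, smul_mulVec, one_mulVec] at h₂
  rw [← RingHom.map_det, ← RingHom.map_adjugate] at h₂
  simpa [φ, mul_comm] using h₂

theorem StringLinkDiagram.exists_isPathSum : ∃ M, D.IsPathSum M := by
  classical
  have h₀ (i : Fin n) : IsPoint (plusWord n) D.slices (0, (i : ℕ)) :=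
    isPoint_iff.2 (by simp [wordAt, plusWord])
  have h₁ (j : Fin n) : IsPoint (plusWord n) D.slices (D.slices.length, (j : ℕ)) :=
    isPoint_iff.2 (by simp only [wordAt_length D.isTangleDiagram]; simp [plusWord])
  refine ⟨fun j i => algebraMap ℚ[X] (RatFunc ℚ)
      (X * D.walkMatrix.adjugate ⟨_, h₀ i⟩ ⟨_, h₁ j⟩) /
    algebraMap ℚ[X] (RatFunc ℚ) D.walkMatrix.det, ?_⟩
  filter_upwards [D.eventually_isSuperharmonic] with t ⟨ht, h, hh⟩ i j
  rw [ratFunc_eval_div _ (D.det_walkMatrix_ne_zero hh ht),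
    ← D.pathSum_eq_adjugate hh ht ⟨_, h₀ i⟩ ⟨_, h₁ j⟩]
  exact (hh.summable _ _).hasSum

variable {D}

theorem StringLinkDiagram.IsPathSum.eventually_eq {M : Matrix (Fin n) (Fin n) (RatFunc ℚ)}
    (hM : D.IsPathSum M) : ∀ᶠ t : ℝ in 𝓝 1, ∀ i j : Fin n,
      (M j i).eval (algebraMap ℚ ℝ) t = pathSum t D.slices (D.slices.length, j) (0, i) :=
  hM.mono fun _ h i j => (h i j).tsum_eq.symm

/-- Agreement at a single transcendental number suffices, since evaluation there is a homomorphism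
from a field and hence injective. -/
theorem StringLinkDiagram.IsPathSum.eq {M M' : Matrix (Fin n) (Fin n) (RatFunc ℚ)}
    (hM : D.IsPathSum M) (hM' : D.IsPathSum M') : M = M' := by
  obtain ⟨t, φ, ⟨h, h'⟩, -, hφ⟩ := exists_evalHom (hM.eventually_eq.and hM'.eventually_eq)
  ext j i : 2
  exact φ.injective (by rw [hφ, hφ, h, h'])

theorem StringLinkDiagram.Move.eq_of_isPathSum {D D' : StringLinkDiagram n} (hDD' : D.Move D')
    {M M' : Matrix (Fin n) (Fin n) (RatFunc ℚ)} (hM : D.IsPathSum M) (hM' : D'.IsPathSum M') :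
    M = M' := by
  obtain ⟨t, φ, ⟨⟨h, h'⟩, ⟨ht, f, hf⟩, -, f', hf'⟩, -, hφ⟩ :=
    exists_evalHom ((hM.eventually_eq.and hM'.eventually_eq).and
      (D.eventually_isSuperharmonic.and D'.eventually_isSuperharmonic))
  ext j i : 2
  exact φ.injective (by rw [hφ, hφ, h, h', hDD'.pathSum_eq hf hf' ht])

theorem StringLink.exists_isPathSum (T : StringLink n) :
    ∃ M, ∀ D : StringLinkDiagram n, D.Presents T → D.IsPathSum M := by
  choose M hM using fun D : StringLinkDiagram n => D.exists_isPathSum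
  refine ⟨Quot.lift M (fun D D' h => h.eq_of_isPathSum (hM D) (hM D')) T, ?_⟩
  rintro D rfl
  exact hM D

theorem isPathSum_randomWalk {T : StringLink n} {D : StringLinkDiagram n} (hD : D.Presents T) :
    D.IsPathSum (randomWalk T) := by
  rw [randomWalk, dif_pos T.exists_isPathSum]
  exact T.exists_isPathSum.choose_spec D hD

theorem onesVec_vecMul_randomWalk (T : StringLink n) : onesVec n ᵥ* randomWalk T = onesVec n := by
  obtain ⟨D, hD⟩ := Quot.exists_rep T
  obtain ⟨t, φ, ⟨h, ht, f, hf⟩, -, hφ⟩ := exists_evalHom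
    ((isPathSum_randomWalk hD).eventually_eq.and D.eventually_isSuperharmonic)
  ext i
  refine φ.injective ?_
  simp only [vecMul, dotProduct, onesVec, one_mul, map_sum, map_one, hφ (randomWalk T _ _), h]
  exact D.sum_pathSum hf ht i

theorem randomWalk_mulVec_powersVec (T : StringLink n) :
    randomWalk T *ᵥ powersVec n = powersVec n := by
  obtain ⟨D, hD⟩ := Quot.exists_rep T
  obtain ⟨t, φ, ⟨h, ht, f, hf⟩, hX, hφ⟩ := exists_evalHom
    ((isPathSum_randomWalk hD).eventually_eq.and D.eventually_isSuperharmonic)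
  ext j
  refine φ.injective ?_
  simp only [mulVec, dotProduct, powersVec, map_sum, map_mul, map_pow, hX, hφ (randomWalk T _ _), h]
  simpa only [mul_comm] using D.sum_pow_mul_pathSum hf ht j

/-- As a quotient of polynomials the entry can be evaluated wherever the denominator does not
vanish, in particular at every `t ≥ 0` when `n > 0`. -/
theorem equilibrium_eq (n : ℕ) (j : Fin n) : equilibrium n j =
    algebraMap ℚ[X] (RatFunc ℚ) (X ^ (j : ℕ)) /
      algebraMap ℚ[X] (RatFunc ℚ) (∑ i : Fin n, X ^ (i : ℕ)) := by
  simp [equilibrium, onesVec, powersVec, dotProduct, div_eq_inv_mul]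

theorem sum_pow_pos {n : ℕ} (hn : 0 < n) {t : ℝ} (ht : 0 ≤ t) : 0 < ∑ i : Fin n, t ^ (i : ℕ) :=
  Finset.sum_pos' (fun _ _ => by positivity) ⟨⟨0, hn⟩, Finset.mem_univ _, by simp⟩

theorem eval_equilibrium {n : ℕ} (hn : 0 < n) {t : ℝ} (ht : 0 ≤ t) (j : Fin n) :
    (equilibrium n j).eval (algebraMap ℚ ℝ) t = t ^ (j : ℕ) / ∑ i : Fin n, t ^ (i : ℕ) := by
  have := (sum_pow_pos hn ht).ne'
  rw [equilibrium_eq, ratFunc_eval_div] <;> simp [eval₂_finsetSum, this]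

theorem sum_equilibrium {n : ℕ} (hn : 0 < n) : ∑ j : Fin n, equilibrium n j = 1 := by
  have h : ∑ i : Fin n, (X : ℚ[X]) ^ (i : ℕ) ≠ 0 := by
    intro h
    -- At `1` the polynomial takes the value `n`.
    have := congrArg (eval₂ (algebraMap ℚ ℝ) 1) h
    simp [eval₂_finsetSum] at this
    omega
  simp only [equilibrium_eq]
  rw [← Finset.sum_div, ← map_sum, div_self (RatFunc.algebraMap_ne_zero h)]

end Rationality

end StringLinks

theorem corollary2p5 (n : ℕ) :
    (∀ T : StringLinks.StringLink n,
      (∀ D : StringLinks.StringLinkDiagram n, D.Presents T →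
        ∀ M : Matrix (Fin n) (Fin n) (RatFunc ℚ),
          D.IsPathSum M ↔ M = StringLinks.randomWalk T) ∧
      StringLinks.onesVec n ᵥ* StringLinks.randomWalk T = StringLinks.onesVec n ∧
      (∀ i : Fin n, ∑ j : Fin n, StringLinks.randomWalk T j i = 1) ∧
      StringLinks.randomWalk T *ᵥ StringLinks.powersVec n = StringLinks.powersVec n) ∧
    (0 < n →
      ∑ j : Fin n, StringLinks.equilibrium n j = 1 ∧
      (∀ t : ℝ, t ∈ Set.Icc 0 1 →
        (∀ j : Fin n, 0 ≤ (StringLinks.equilibrium n j).eval (algebraMap ℚ ℝ) t) ∧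
        ∑ j : Fin n, (StringLinks.equilibrium n j).eval (algebraMap ℚ ℝ) t = 1) ∧
      ∀ T : StringLinks.StringLink n,
        StringLinks.randomWalk T *ᵥ StringLinks.equilibrium n = StringLinks.equilibrium n) := by
  refine ⟨fun T => ⟨fun D hD M => ⟨fun hM => hM.eq (StringLinks.isPathSum_randomWalk hD), ?_⟩,
    StringLinks.onesVec_vecMul_randomWalk T, fun i => ?_,
    StringLinks.randomWalk_mulVec_powersVec T⟩,
    fun hn => ⟨StringLinks.sum_equilibrium hn, fun t ht => ⟨fun j => ?_, ?_⟩, fun T => ?_⟩⟩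
  · rintro rfl
    exact StringLinks.isPathSum_randomWalk hD
  · simpa [vecMul, dotProduct, StringLinks.onesVec] using
      congrFun (StringLinks.onesVec_vecMul_randomWalk T) i
  · rw [StringLinks.eval_equilibrium hn ht.1]
    exact div_nonneg (pow_nonneg ht.1 _) (StringLinks.sum_pow_pos hn ht.1).le
  · simp only [StringLinks.eval_equilibrium hn ht.1]
    rw [← Finset.sum_div, div_self (StringLinks.sum_pow_pos hn ht.1).ne']
  · rw [StringLinks.equilibrium, mulVec_smul, StringLinks.randomWalk_mulVec_powersVec]
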